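/- Let $k$ be a field and let $A=\bigoplus_{i\in\mathbb{N}}A_i$ be an $\mathbb{N}$-graded Artin--Schelter Gorenstein $k$-algebra of dimension $d$. This means that $A$ is left and right Noetherian, $\dim_k A_i<\infty$ for all $i$, $A$ has injective dimension $d<\infty$ as a right and as a left module over itself, and, for each simple graded right $A$-module $S$ concentrated in degree $0$, $\operatorname{Ext}^{\ell}_A(S,A)=0$ for $\ell\neq d$, while $\operatorname{Ext}^d_A(S,A)$ is isomorphic, as a graded left $A$-module, to a degree shift $S'(p)$, $p\in\mathbb{Z}$, of a simple graded left $A$-module $S'$ concentrated in degree $0$. (The case $A_0\ne k$ is allowed.) Let $\mathsf{mod}^{\mathbb{Z}}A$ be the category of finitely generated $\mathbb{Z}$-graded right $A$-modules, $\mathsf{mod}^{\mathbb{Z}}_0A$ its full subcategory of modules of finite length, and $\mathsf{proj}^{\mathbb{Z}}A$ its full subcategory of projective modules. Put \[\mathsf{D}_{\mathrm{sg},0}^{\mathbb{Z}}(A):=\mathsf{thick}\{\mathsf{mod}^{\mathbb{Z}}_0A,\ \mathsf{proj}^{\mathbb{Z}}A\}\,/\,\mathsf{K}^{\mathrm b}(\mathsf{proj}^{\mathbb{Z}}A),\]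 the Verdier quotient of the smallest thick subcategory of $\mathsf{D}^{\mathrm b}(\mathsf{mod}^{\mathbb{Z}}A)$ that contains $\mathsf{mod}^{\mathbb{Z}}_0A$ and $\mathsf{proj}^{\mathbb{Z}}A$. An object $T$ of a triangulated category $\mathscr T$ is called silting if $\operatorname{Hom}_{\mathscr T}(T,T[i])=0$ for all $i\ge 1$ and the smallest thick subcategory of $\mathscr T$ containing $T$ is $\mathscr T$. If $\mathsf{D}_{\mathrm{sg},0}^{\mathbb{Z}}(A)$ admits a silting object, then $\operatorname{gldim}A_0$ is finite. -/

import Mathlib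

open CategoryTheory CategoryTheory.Limits

universe v u

/-! ## Graded modules -/

section Internal

variable {X : Type*} [AddCommGroup X]

/-- A criterion for internal direct sums by means of component maps. -/
theorem isInternal_of_components (D : ℤ → AddSubgroup X) (c : ℤ → X →+ X)
    (h₁ : ∀ i x, x ∈ D i → c i x = x) (h₂ : ∀ i j x, i ≠ j → x ∈ D j → c i x = 0)
    (h₃ : ∀ x, x ∈ ⨆ i, D i) : DirectSum.IsInternal D := by
  have key : ∀ (y : DirectSum ℤ fun i => D i) (i : ℤ),
      c i (DirectSum.coeAddMonoidHom D y) = (y i : X) := by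
    intro y i
    induction y using DirectSum.induction_on with
    | zero => simp
    | of j x =>
      rw [DirectSum.coeAddMonoidHom_of, DirectSum.coe_of_apply]
      split_ifs with h
      · subst h
        exact h₁ _ _ x.2
      · exact h₂ _ _ _ (fun h' => h h'.symm) x.2
    | add a b ha hb => rw [map_add, map_add, ha, hb]; rfl
  constructor
  · intro a b hab
    ext i
    rw [← key a i, ← key b i, hab]
  · intro x
    have : (⨆ i, D i) ≤ (DirectSum.coeAddMonoidHom D).range :=
      iSup_le fun i y hy => ⟨DirectSum.of (fun i => D i) i ⟨y, hy⟩, by simp⟩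
    exact this (h₃ x)

/-- The homogeneous component of degree `i` in an internally graded abelian group. -/
noncomputable def gradedComponent (D : ℤ → AddSubgroup X) (h : DirectSum.IsInternal D) (i : ℤ) :
    X →+ X :=
  (D i).subtype.comp ((DFinsupp.evalAddMonoidHom i : (DirectSum ℤ fun i => D i) →+ D i).comp
    (AddEquiv.ofBijective (DirectSum.coeAddMonoidHom D) h).symm.toAddMonoidHom)

variable {D : ℤ → AddSubgroup X} (h : DirectSum.IsInternal D)

theorem gradedComponent_mem (i : ℤ) (x : X) : gradedComponent D h i x ∈ D i :=
  Subtype.property _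

theorem ofBijective_symm_of_mem {j : ℤ} {x : X} (hx : x ∈ D j) :
    (AddEquiv.ofBijective (DirectSum.coeAddMonoidHom D) h).symm x =
      DirectSum.of (fun i => D i) j ⟨x, hx⟩ := by
  rw [AddEquiv.symm_apply_eq]
  exact (DirectSum.coeAddMonoidHom_of D j ⟨x, hx⟩).symm

theorem gradedComponent_of_mem {i : ℤ} {x : X} (hx : x ∈ D i) : gradedComponent D h i x = x := by
  change (((AddEquiv.ofBijective (DirectSum.coeAddMonoidHom D) h).symm x) i : X) = x
  rw [ofBijective_symm_of_mem h hx, DirectSum.of_eq_same]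

theorem gradedComponent_of_mem_ne {i j : ℤ} {x : X} (hij : i ≠ j) (hx : x ∈ D j) :
    gradedComponent D h i x = 0 := by
  change (((AddEquiv.ofBijective (DirectSum.coeAddMonoidHom D) h).symm x) i : X) = 0
  rw [ofBijective_symm_of_mem h hx, DirectSum.of_eq_of_ne _ _ _ hij]
  rfl

theorem exists_sum_gradedComponent (x : X) :
    ∃ s : Finset ℤ, x = ∑ i ∈ s, gradedComponent D h i x := by
  classical
  obtain ⟨y, rfl⟩ := h.2 x
  refine ⟨DFinsupp.support y, ?_⟩
  conv_lhs => rw [← DirectSum.sum_support_of y, map_sum]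
  refine Finset.sum_congr rfl fun i _ => ?_
  rw [DirectSum.coeAddMonoidHom_of]
  change _ = (((AddEquiv.ofBijective (DirectSum.coeAddMonoidHom D) h).symm
    ((AddEquiv.ofBijective (DirectSum.coeAddMonoidHom D) h) y)) i : X)
  rw [AddEquiv.symm_apply_apply]

theorem mem_of_gradedComponent_eq_zero {i : ℤ} {x : X}
    (hx : ∀ j, j ≠ i → gradedComponent D h j x = 0) : x ∈ D i := by
  obtain ⟨s, hs⟩ := exists_sum_gradedComponent h x
  rw [hs]
  refine sum_mem fun j _ => ?_
  by_cases hj : j = i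
  · subst hj
    exact gradedComponent_mem h _ _
  · rw [hx j hj]
    exact zero_mem _

/-- Additive maps that preserve degrees commute with taking components. -/
theorem map_gradedComponent {Y : Type*} [AddCommGroup Y] {E : ℤ → AddSubgroup Y}
    (h' : DirectSum.IsInternal E) (f : X →+ Y) (hf : ∀ i x, x ∈ D i → f x ∈ E i)
    (i : ℤ) (x : X) : f (gradedComponent D h i x) = gradedComponent E h' i (f x) := by
  obtain ⟨s, hs⟩ := exists_sum_gradedComponent h x
  rw [hs]
  simp only [map_sum]
  refine Finset.sum_congr rfl fun j _ => ?_
  have hj := gradedComponent_mem h j x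
  by_cases hij : i = j
  · subst hij
    rw [gradedComponent_of_mem h hj, gradedComponent_of_mem h' (hf _ _ hj)]
  · rw [gradedComponent_of_mem_ne h hij hj, gradedComponent_of_mem_ne h' hij (hf _ _ hj), map_zero]

end Internal

/-- A finitely generated `ℤ`-graded left module over the `ℤ`-graded ring `R = ⨁ 𝓡 i`. -/
structure GrMod {k : Type v} [Field k] {R : Type u} [Ring R] [Algebra k R]
    (𝓡 : ℤ → Submodule k R) where
  carrier : Type u
  [addCommGroup : AddCommGroup carrier]
  [module : Module R carrier]
  deg : ℤ → AddSubgroup carrier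
  isInternal : DirectSum.IsInternal deg
  smul_mem : ∀ {i j : ℤ} {r : R} {m : carrier}, r ∈ 𝓡 i → m ∈ deg j → r • m ∈ deg (i + j)
  finite : Module.Finite R carrier

namespace GrMod

attribute [instance] GrMod.addCommGroup GrMod.module GrMod.finite

variable {k : Type v} [Field k] {R : Type u} [Ring R] [Algebra k R] {𝓡 : ℤ → Submodule k R}

instance : CoeSort (GrMod 𝓡) (Type u) := ⟨GrMod.carrier⟩

/-- Morphisms of graded modules: module homomorphisms that preserve the degree. -/
@[ext]
structure Hom (M N : GrMod 𝓡) where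
  toLin : M →ₗ[R] N
  map_deg : ∀ i (m : M), m ∈ M.deg i → toLin m ∈ N.deg i

instance : Category (GrMod 𝓡) where
  Hom := Hom
  id M := ⟨LinearMap.id, fun _ _ h => h⟩
  comp f g := ⟨g.toLin.comp f.toLin, fun i m h => g.map_deg i _ (f.map_deg i m h)⟩

/-- The linear map underlying a morphism. -/
def lin {M N : GrMod 𝓡} (f : M ⟶ N) : M →ₗ[R] N := Hom.toLin f

/-- Constructor for morphisms. -/
def ofLin {M N : GrMod 𝓡} (f : M →ₗ[R] N) (hf : ∀ i (m : M), m ∈ M.deg i → f m ∈ N.deg i) :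
    M ⟶ N := Hom.mk f hf

theorem lin_mem {M N : GrMod 𝓡} (f : M ⟶ N) {i : ℤ} {m : M} (h : m ∈ M.deg i) :
    lin f m ∈ N.deg i := Hom.map_deg f i m h

@[simp] theorem lin_ofLin {M N : GrMod 𝓡} (f : M →ₗ[R] N) (hf) :
    lin (ofLin f hf : M ⟶ N) = f := rfl

@[simp] theorem lin_id (M : GrMod 𝓡) : lin (𝟙 M) = LinearMap.id := rfl

@[simp] theorem lin_comp {M N P : GrMod 𝓡} (f : M ⟶ N) (g : N ⟶ P) :
    lin (f ≫ g) = (lin g).comp (lin f) := rfl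

theorem hom_ext {M N : GrMod 𝓡} {f g : M ⟶ N} (h : lin f = lin g) : f = g := Hom.ext h

theorem hom_ext' {M N : GrMod 𝓡} {f g : M ⟶ N} (h : ∀ m, lin f m = lin g m) : f = g :=
  hom_ext (LinearMap.ext h)

section Preadditive

variable {M N : GrMod 𝓡}

instance : Zero (M ⟶ N) := ⟨ofLin 0 fun _ _ _ => zero_mem _⟩
instance : Add (M ⟶ N) :=
  ⟨fun f g => ofLin (lin f + lin g) fun _ _ h => add_mem (lin_mem f h) (lin_mem g h)⟩
instance : Neg (M ⟶ N) := ⟨fun f => ofLin (-lin f) fun _ _ h => neg_mem (lin_mem f h)⟩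
instance : Sub (M ⟶ N) :=
  ⟨fun f g => ofLin (lin f - lin g) fun _ _ h => sub_mem (lin_mem f h) (lin_mem g h)⟩
instance : SMul ℕ (M ⟶ N) := ⟨fun n f => ofLin (n • lin f) fun _ _ h => nsmul_mem (lin_mem f h) n⟩
instance : SMul ℤ (M ⟶ N) := ⟨fun n f => ofLin (n • lin f) fun _ _ h => zsmul_mem (lin_mem f h) n⟩

instance : AddCommGroup (M ⟶ N) :=
  Function.Injective.addCommGroup (lin : (M ⟶ N) → (M →ₗ[R] N)) (fun _ _ h => hom_ext h) rfl
    (fun _ _ => rfl) (fun _ => rfl) (fun _ _ => rfl) (fun _ _ => rfl) (fun _ _ => rfl)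

@[simp] theorem lin_zero : lin (0 : M ⟶ N) = 0 := rfl
@[simp] theorem lin_add (f g : M ⟶ N) : lin (f + g) = lin f + lin g := rfl
@[simp] theorem lin_sub (f g : M ⟶ N) : lin (f - g) = lin f - lin g := rfl

end Preadditive

instance : Preadditive (GrMod 𝓡) where
  add_comp _ _ _ f f' g := hom_ext (by
    rw [lin_comp, lin_add, lin_add, lin_comp, lin_comp, LinearMap.comp_add])
  comp_add _ _ _ f g g' := rfl

/-- The homogeneous component of degree `i`. -/
noncomputable def comp (M : GrMod 𝓡) (i : ℤ) : M →+ M := gradedComponent M.deg M.isInternal i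

theorem lin_comp_apply {M N : GrMod 𝓡} (f : M ⟶ N) (i : ℤ) (m : M) :
    lin f (M.comp i m) = N.comp i (lin f m) :=
  map_gradedComponent M.isInternal N.isInternal (lin f).toAddMonoidHom
    (fun _ _ h => lin_mem f h) i m

/-- An element whose image under an injective morphism is homogeneous is homogeneous. -/
theorem mem_deg_of_lin_mem {M N : GrMod 𝓡} (f : M ⟶ N) (hf : Function.Injective (lin f))
    {i : ℤ} {m : M} (h : lin f m ∈ N.deg i) : m ∈ M.deg i := by
  refine mem_of_gradedComponent_eq_zero M.isInternal fun j hj => hf ?_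
  have := lin_comp_apply f j m
  rw [map_zero]
  exact this.trans (gradedComponent_of_mem_ne N.isInternal hj h)

/-- A homogeneous element in the image of a morphism has a homogeneous preimage. -/
theorem exists_mem_deg {M N : GrMod 𝓡} (f : M ⟶ N) {i : ℤ} {m : M}
    (h : lin f m ∈ N.deg i) : ∃ m' ∈ M.deg i, lin f m' = lin f m :=
  ⟨M.comp i m, gradedComponent_mem M.isInternal i m,
    (lin_comp_apply f i m).trans (gradedComponent_of_mem N.isInternal h)⟩

/-- The graded submodule on a homogeneous submodule. -/
def sub [IsNoetherianRing R] (M : GrMod 𝓡) (N : Submodule R M)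
    (hN : ∀ i, ∀ m ∈ N, M.comp i m ∈ N) : GrMod 𝓡 where
  carrier := N
  deg i := (M.deg i).comap N.subtype.toAddMonoidHom
  isInternal := by
    refine isInternal_of_components _
      (fun i => ((M.comp i).comp N.subtype.toAddMonoidHom).codRestrict N
        (fun x => hN i _ x.2)) ?_ ?_ ?_
    · intro i x hx
      exact Subtype.ext (gradedComponent_of_mem M.isInternal hx)
    · intro i j x hij hx
      exact Subtype.ext (gradedComponent_of_mem_ne M.isInternal hij hx)
    · intro x
      obtain ⟨s, hs⟩ := exists_sum_gradedComponent M.isInternal (x : M)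
      have : x = ∑ i ∈ s, ⟨M.comp i x, hN i _ x.2⟩ := by
        apply Subtype.ext
        rw [AddSubmonoidClass.coe_finsetSum]
        exact hs
      rw [this]
      refine sum_mem fun i _ => AddSubgroup.mem_iSup_of_mem i ?_
      exact gradedComponent_mem M.isInternal i _
  smul_mem hr hm := M.smul_mem hr hm
  finite := inferInstance

/-- The graded quotient module by a homogeneous submodule. -/
def quot (M : GrMod 𝓡) (N : Submodule R M)
    (hN : ∀ i, ∀ m ∈ N, M.comp i m ∈ N) : GrMod 𝓡 where
  carrier := M ⧸ N
  deg i := (M.deg i).map N.mkQ.toAddMonoidHom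
  isInternal := by
    have hmk : ∀ x : M ⧸ N, ∃ m, N.mkQ m = x := N.mkQ_surjective
    let c : ℤ → (M ⧸ N) →+ (M ⧸ N) := fun i =>
      QuotientAddGroup.lift N.toAddSubgroup (N.mkQ.toAddMonoidHom.comp (M.comp i)) (by
        intro x hx
        exact (Submodule.Quotient.mk_eq_zero N).2 (hN i x hx))
    have hc : ∀ i m, c i (N.mkQ m) = N.mkQ (M.comp i m) := fun i m => rfl
    refine isInternal_of_components _ c ?_ ?_ ?_
    · rintro i _ ⟨m, hm, rfl⟩
      exact (hc i m).trans (congrArg N.mkQ (gradedComponent_of_mem M.isInternal hm))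
    · rintro i j _ hij ⟨m, hm, rfl⟩
      refine (hc i m).trans ?_
      rw [show M.comp i m = 0 from gradedComponent_of_mem_ne M.isInternal hij hm, map_zero]
    · intro x
      obtain ⟨m, rfl⟩ := hmk x
      obtain ⟨s, hs⟩ := exists_sum_gradedComponent M.isInternal m
      rw [hs, map_sum]
      exact sum_mem fun i _ => AddSubgroup.mem_iSup_of_mem i
        ⟨_, gradedComponent_mem M.isInternal i m, rfl⟩
  smul_mem := by
    rintro i j r _ hr ⟨m, hm, rfl⟩
    exact ⟨r • m, M.smul_mem hr hm, map_smul N.mkQ r m⟩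
  finite := inferInstance

/-- The direct sum of two graded modules. -/
def prod (M N : GrMod 𝓡) : GrMod 𝓡 where
  carrier := M × N
  deg i := (M.deg i).prod (N.deg i)
  isInternal := by
    refine isInternal_of_components _ (fun i => (M.comp i).prodMap (N.comp i)) ?_ ?_ ?_
    · rintro i ⟨m, n⟩ ⟨hm, hn⟩
      exact Prod.ext (gradedComponent_of_mem M.isInternal hm)
        (gradedComponent_of_mem N.isInternal hn)
    · rintro i j ⟨m, n⟩ hij ⟨hm, hn⟩
      exact Prod.ext (gradedComponent_of_mem_ne M.isInternal hij hm)
        (gradedComponent_of_mem_ne N.isInternal hij hn)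
    · rintro ⟨m, n⟩
      obtain ⟨s, hs⟩ := exists_sum_gradedComponent M.isInternal m
      obtain ⟨t, ht⟩ := exists_sum_gradedComponent N.isInternal n
      have : ((m, n) : M × N) = AddMonoidHom.inl M N m + AddMonoidHom.inr M N n := by simp
      rw [this]
      refine add_mem ?_ ?_
      · rw [hs, map_sum]
        exact sum_mem fun i _ => AddSubgroup.mem_iSup_of_mem i
          ⟨gradedComponent_mem M.isInternal i m, zero_mem _⟩
      · rw [ht, map_sum]
        exact sum_mem fun i _ => AddSubgroup.mem_iSup_of_mem i
          ⟨zero_mem _, gradedComponent_mem N.isInternal i n⟩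
  smul_mem hr hm := ⟨M.smul_mem hr hm.1, N.smul_mem hr hm.2⟩
  finite := inferInstance

/-- The zero graded module. -/
def zero (𝓡 : ℤ → Submodule k R) : GrMod 𝓡 where
  carrier := PUnit
  deg _ := ⊤
  isInternal := isInternal_of_components _ (fun _ => 0) (fun _ _ _ => rfl) (fun _ _ _ _ _ => rfl)
    (fun _ => AddSubgroup.mem_iSup_of_mem 0 trivial)
  smul_mem _ _ := trivial
  finite := inferInstance

theorem isZero_of_subsingleton (M : GrMod 𝓡) [Subsingleton M] : IsZero M := by
  rw [IsZero.iff_id_eq_zero]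
  exact hom_ext' fun m => Subsingleton.elim _ _

instance : HasZeroObject (GrMod 𝓡) :=
  ⟨zero 𝓡, by
    have : Subsingleton (zero 𝓡) := inferInstanceAs (Subsingleton PUnit)
    exact isZero_of_subsingleton _⟩

instance : HasBinaryProducts (GrMod 𝓡) := by
    refine @hasBinaryProducts_of_hasLimit_pair _ _ ?_
    intro M N
    refine ⟨⟨⟨BinaryFan.mk (P := prod M N)
      (ofLin (LinearMap.fst R M N) fun _ _ h => h.1)
      (ofLin (LinearMap.snd R M N) fun _ _ h => h.2), ?_⟩⟩⟩
    exact BinaryFan.isLimitMk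
      (fun s => ofLin ((lin s.fst).prod (lin s.snd))
        fun _ _ h => ⟨lin_mem s.fst h, lin_mem s.snd h⟩)
      (fun s => rfl) (fun s => rfl)
      (fun s m h₁ h₂ => hom_ext' fun x => Prod.ext
        (congrArg (fun f => lin f x) h₁) (congrArg (fun f => lin f x) h₂))

instance : HasFiniteProducts (GrMod 𝓡) :=
  hasFiniteProducts_of_has_binary_and_terminal

theorem comp_mem_ker {M N : GrMod 𝓡} (f : M ⟶ N) (i : ℤ) (m : M)
    (hm : m ∈ LinearMap.ker (lin f)) : M.comp i m ∈ LinearMap.ker (lin f) := by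
  rw [LinearMap.mem_ker] at hm ⊢
  rw [lin_comp_apply, hm, map_zero]

theorem comp_mem_range {M N : GrMod 𝓡} (f : M ⟶ N) (i : ℤ) (n : N)
    (hn : n ∈ LinearMap.range (lin f)) : N.comp i n ∈ LinearMap.range (lin f) := by
  obtain ⟨m, rfl⟩ := hn
  exact ⟨M.comp i m, lin_comp_apply f i m⟩

section Cokernel

variable {M N : GrMod 𝓡} (f : M ⟶ N)

/-- The cokernel of a morphism of graded modules. -/
def coker : GrMod 𝓡 := quot N (LinearMap.range (lin f)) (comp_mem_range f)

/-- The projection onto the cokernel. -/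
def cokerπ : N ⟶ coker f :=
  ofLin (LinearMap.range (lin f)).mkQ fun _ m h => ⟨m, h, rfl⟩

theorem comp_cokerπ : f ≫ cokerπ f = 0 :=
  hom_ext' fun m => (Submodule.Quotient.mk_eq_zero _).2 ⟨m, rfl⟩

/-- The universal property of the cokernel. -/
def isColimitCoker : IsColimit (CokernelCofork.ofπ (cokerπ f) (comp_cokerπ f)) :=
  CokernelCofork.IsColimit.ofπ _ _
    (fun {P} g hg => (ofLin ((LinearMap.range (lin f)).liftQ (lin g) (by
        rintro _ ⟨m, rfl⟩
        exact congrArg (fun f => lin f m) hg)) (by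
        rintro i _ ⟨m, hm, rfl⟩
        exact lin_mem g hm) : coker f ⟶ P))
    (fun _ _ => rfl)
    (fun _ _ _ hm => hom_ext' fun x => by
      obtain ⟨y, rfl⟩ := (LinearMap.range (lin f)).mkQ_surjective x
      exact congrArg (fun f => lin f y) hm)

instance : HasCokernels (GrMod 𝓡) := ⟨fun f => ⟨⟨⟨_, isColimitCoker f⟩⟩⟩⟩

theorem lin_surjective_of_epi [Epi f] :
    Function.Surjective (lin f) := by
  intro n
  have : cokerπ f = 0 := zero_of_epi_comp f (comp_cokerπ f)
  have h : (LinearMap.range (lin f)).mkQ n = 0 := congrArg (fun g => lin g n) this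
  exact (Submodule.Quotient.mk_eq_zero _).1 h

end Cokernel

section Noetherian

variable [IsNoetherianRing R] {M N : GrMod 𝓡} (f : M ⟶ N)

/-- The kernel of a morphism of graded modules. -/
def ker : GrMod 𝓡 := sub M (LinearMap.ker (lin f)) (comp_mem_ker f)

/-- The inclusion of the kernel. -/
def kerι : ker f ⟶ M := ofLin (LinearMap.ker (lin f)).subtype fun _ _ h => h

theorem kerι_comp : kerι f ≫ f = 0 := hom_ext' fun m => m.2

/-- The universal property of the kernel. -/
def isLimitKer : IsLimit (KernelFork.ofι (kerι f) (kerι_comp f)) :=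
  KernelFork.IsLimit.ofι _ _
    (fun {P} g hg => (ofLin ((lin g).codRestrict (LinearMap.ker (lin f))
        (fun m => congrArg (fun f => lin f m) hg)) (fun _ _ h => lin_mem g h) : P ⟶ ker f))
    (fun _ _ => rfl)
    (fun _ _ _ hm => hom_ext' fun x => Subtype.ext (congrArg (fun f => lin f x) hm))

instance : HasKernels (GrMod 𝓡) := ⟨fun f => ⟨⟨⟨_, isLimitKer f⟩⟩⟩⟩

theorem lin_injective_of_mono [Mono f] : Function.Injective (lin f) := by
  rw [← LinearMap.ker_eq_bot, Submodule.eq_bot_iff]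
  intro m hm
  have : kerι f = 0 := zero_of_comp_mono f (kerι_comp f)
  exact congrArg (fun g : ker f ⟶ M => lin g (⟨m, hm⟩ : LinearMap.ker (lin f))) this

/-- A monomorphism is the kernel of its cokernel. -/
@[reducible]
noncomputable def normalMono [Mono f] : NormalMono f where
  Z := coker f
  g := cokerπ f
  w := comp_cokerπ f
  isLimit := by
    have hinj := lin_injective_of_mono f
    have key : ∀ {P : GrMod 𝓡} (g : P ⟶ N), g ≫ cokerπ f = 0 →
        ∀ x, lin g x ∈ LinearMap.range (lin f) := fun g hg x =>
      (Submodule.Quotient.mk_eq_zero _).1 (congrArg (fun h => lin h x) hg)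
    have key' : ∀ {P : GrMod 𝓡} (g : P ⟶ N) (hg : g ≫ cokerπ f = 0) (x : P),
        lin f ((LinearEquiv.ofInjective (lin f) hinj).symm ⟨lin g x, key g hg x⟩) = lin g x :=
      fun g hg x => congrArg Subtype.val
        ((LinearEquiv.ofInjective (lin f) hinj).apply_symm_apply ⟨lin g x, key g hg x⟩)
    exact KernelFork.IsLimit.ofι _ _
      (fun {P} g hg => ofLin ((LinearEquiv.ofInjective (lin f) hinj).symm.toLinearMap.comp
          ((lin g).codRestrict _ (key g hg))) (fun i x hx => by
            refine mem_deg_of_lin_mem f hinj ?_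
            exact (key' g hg x).symm ▸ lin_mem g hx))
      (fun g hg => hom_ext' fun x => key' g hg x)
      (fun g hg m hm => hom_ext' fun x => hinj
        ((congrArg (fun h => lin h x) hm).trans (key' g hg x).symm))

/-- An epimorphism is the cokernel of its kernel. -/
@[reducible]
noncomputable def normalEpi [Epi f] : NormalEpi f where
  W := ker f
  g := kerι f
  w := kerι_comp f
  isColimit := by
    have hsurj := lin_surjective_of_epi f
    have key : ∀ {P : GrMod 𝓡} (g : M ⟶ P), kerι f ≫ g = 0 →
        LinearMap.ker (lin f) ≤ LinearMap.ker (lin g) := fun {P} g hg x hx =>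
      congrArg (fun h : ker f ⟶ P => lin h (⟨x, hx⟩ : LinearMap.ker (lin f))) hg
    have key' : ∀ {P : GrMod 𝓡} (g : M ⟶ P) (hg : kerι f ≫ g = 0) (x : M),
        (LinearMap.ker (lin f)).liftQ (lin g) (key g hg)
          (((lin f).quotKerEquivOfSurjective hsurj).symm (lin f x)) = lin g x := by
      intro P g hg x
      have : ((lin f).quotKerEquivOfSurjective hsurj).symm (lin f x) =
          (LinearMap.ker (lin f)).mkQ x := by
        rw [LinearEquiv.symm_apply_eq]
        rfl
      rw [this]
      rfl
    exact CokernelCofork.IsColimit.ofπ _ _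
      (fun {P} g hg => ofLin (((LinearMap.ker (lin f)).liftQ (lin g) (key g hg)).comp
          ((lin f).quotKerEquivOfSurjective hsurj).symm.toLinearMap) (fun i n hn => by
            obtain ⟨m, rfl⟩ := hsurj n
            obtain ⟨m', hm', h⟩ := exists_mem_deg f hn
            rw [← h]
            exact (key' g hg m').symm ▸ lin_mem g hm'))
      (fun g hg => hom_ext' fun x => key' g hg x)
      (fun g hg m hm => hom_ext' fun n => by
        obtain ⟨x, rfl⟩ := hsurj n
        exact (congrArg (fun h => lin h x) hm).trans (key' g hg x).symm)

/-- Finitely generated graded modules over a Noetherian graded ring form an abelian category. -/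
noncomputable instance : Abelian (GrMod 𝓡) where
  normalMonoOfMono f _ := ⟨normalMono f⟩
  normalEpiOfEpi f _ := ⟨normalEpi f⟩

instance : HasExt.{u + 1} (GrMod 𝓡) := HasExt.standard _

noncomputable instance : HasDerivedCategory.{u + 1} (GrMod 𝓡) := HasDerivedCategory.standard _

end Noetherian

/-- `M` is concentrated in degree `0`. -/
def IsConcentratedInDegreeZero (M : GrMod 𝓡) : Prop := ∀ i, i ≠ 0 → M.deg i = ⊥

end GrMod

/-! ## The derived category: perfect complexes, thick subcategories and Verdier quotients -/

section Triangulated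

open Pretriangulated
open scoped ZeroObject

/-- An object `T` of a triangulated category is silting if `Hom(T, T[i]) = 0` for all `i ≥ 1` and
the smallest thick subcategory that contains `T` is the whole category. -/
def IsSilting {C : Type*} [Category* C] [HasZeroObject C] [HasShift C ℤ] [Preadditive C]
    [∀ n : ℤ, (shiftFunctor C n).Additive] [Pretriangulated C] (T : C) : Prop :=
  (∀ i : ℤ, 1 ≤ i → ∀ f : T ⟶ T⟦i⟧, f = 0) ∧
    (ObjectProperty.singleton T).IsClassicalTriangulatedGenerator

variable (C : Type*) [Category* C] [Abelian C]

/-- A bounded cochain complex all of whose terms are projective. -/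
def IsBoundedProjective : ObjectProperty (CochainComplex C ℤ) := fun K =>
  (∀ n, Projective (K.X n)) ∧ ∃ a b : ℤ, ∀ n, n < a ∨ b < n → IsZero (K.X n)

variable {C} in
theorem IsBoundedProjective.isKProjective {K : CochainComplex C ℤ} (hK : IsBoundedProjective C K) :
    K.IsKProjective := by
  obtain ⟨hK, a, b, hab⟩ := hK
  have : K.IsStrictlyLE b := by
    rw [CochainComplex.isStrictlyLE_iff]
    exact fun i hi => hab i (Or.inr hi)
  exact CochainComplex.isKProjective_of_projective K b

variable {C} in
theorem IsBoundedProjective.mappingCone {K L : CochainComplex C ℤ} (hK : IsBoundedProjective C K)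
    (hL : IsBoundedProjective C L) (f : K ⟶ L) :
    IsBoundedProjective C (CochainComplex.mappingCone f) := by
  obtain ⟨hK, a, b, hab⟩ := hK
  obtain ⟨hL, a', b', hab'⟩ := hL
  refine ⟨fun n => ?_, min (a - 1) a', max b b', fun n hn => ?_⟩
  · have := hK (n + 1)
    have := hL n
    exact Projective.of_iso
      (HomologicalComplex.homotopyCofiber.XIsoBiprod f n (n + 1) rfl).symm inferInstance
  · refine IsZero.of_iso ?_
      (HomologicalComplex.homotopyCofiber.XIsoBiprod f n (n + 1) rfl)
    rw [biprod_isZero_iff]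
    exact ⟨hab _ (by lia), hab' _ (by lia)⟩

variable [HasDerivedCategory C]

/-- `K^b(proj C)` as a subcategory of the derived category: the objects that are isomorphic to a
bounded complex of projectives. -/
def perfectComplexes : ObjectProperty (DerivedCategory C) := fun X =>
  ∃ K : CochainComplex C ℤ, IsBoundedProjective C K ∧ Nonempty (DerivedCategory.Q.obj K ≅ X)

instance : (perfectComplexes C).IsClosedUnderIsomorphisms where
  of_iso := by
    rintro X Y e ⟨K, hK, ⟨e'⟩⟩
    exact ⟨K, hK, ⟨e' ≪≫ e⟩⟩

instance : (perfectComplexes C).ContainsZero where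
  exists_zero := by
    refine ⟨_, (isZero_zero _), 0, ⟨fun n => ?_, 0, 0, fun n _ => ?_⟩, ⟨?_⟩⟩
    · have : IsZero ((0 : CochainComplex C ℤ).X n) :=
        (HomologicalComplex.eval C _ n).map_isZero (isZero_zero _)
      exact this.projective
    · exact (HomologicalComplex.eval C _ n).map_isZero (isZero_zero _)
    · exact (DerivedCategory.Q.map_isZero (isZero_zero _)).iso (isZero_zero _)

instance : (perfectComplexes C).IsStableUnderShift ℤ where
  isStableUnderShiftBy i := ⟨by
    rintro X ⟨K, ⟨hK, a, b, hab⟩, ⟨e⟩⟩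
    refine ⟨K⟦i⟧, ⟨fun n => hK (n + i), a - i, b - i, fun n hn => hab (n + i) (by lia)⟩, ⟨?_⟩⟩
    exact (DerivedCategory.Q.commShiftIso i).app K ≪≫ (shiftFunctor _ i).mapIso e⟩

instance : (perfectComplexes C).IsTriangulatedClosed₃ := by
  refine ObjectProperty.IsTriangulatedClosed₃.mk' ?_
  rintro T hT ⟨K, hK, ⟨e₁⟩⟩ ⟨L, hL, ⟨e₂⟩⟩
  have := hK.isKProjective
  obtain ⟨g, hg⟩ := (CochainComplex.IsKProjective.Qh_map_bijective K
    ((HomotopyCategory.quotient _ _).obj L)).2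
      ((DerivedCategory.quotientCompQhIso C).hom.app K ≫ e₁.hom ≫ T.mor₁ ≫ e₂.inv ≫
        (DerivedCategory.quotientCompQhIso C).inv.app L)
  obtain ⟨φ, rfl⟩ := (HomotopyCategory.quotient _ _).map_surjective g
  have hφ : DerivedCategory.Q.map φ = e₁.hom ≫ T.mor₁ ≫ e₂.inv := by
    rw [← cancel_epi ((DerivedCategory.quotientCompQhIso C).hom.app K),
      ← DerivedCategory.quotientCompQhIso_hom_naturality, hg]
    simp
  refine ⟨CochainComplex.mappingCone φ, hK.mappingCone hL φ, ?_⟩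
  obtain ⟨e⟩ : Nonempty (DerivedCategory.Q.mapTriangle.obj
      (CochainComplex.mappingCone.triangle φ) ≅ T) := by
    refine ⟨isoTriangleOfIso₁₂ _ _ (DerivedCategory.mappingCone_triangle_distinguished φ) hT
      e₁ e₂ ?_⟩
    change DerivedCategory.Q.map φ ≫ e₂.hom = e₁.hom ≫ T.mor₁
    rw [hφ]
    simp
  exact ⟨Triangle.π₃.mapIso e⟩

instance : (perfectComplexes C).IsTriangulated where
  toIsTriangulatedClosed₂ := .of_isTriangulatedClosed₃

end Triangulated

/-! ## Graded algebras -/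

section GradedAlgebras

variable {k : Type v} [Field k] {A : Type u} [Ring A] [Algebra k A] (𝒜 : ℤ → Submodule k A)

/-- The grading of the opposite algebra of `A`. -/
def opGrading : ℤ → Submodule k Aᵐᵒᵖ := fun i =>
  (𝒜 i).map (MulOpposite.opLinearEquiv k : A ≃ₗ[k] Aᵐᵒᵖ).toLinearMap

/-- The category of finitely generated `ℤ`-graded right `A`-modules. -/
abbrev RightGrMod := GrMod (opGrading 𝒜)

/-- The category of finitely generated `ℤ`-graded left `A`-modules. -/
abbrev LeftGrMod := GrMod 𝒜

section Regular

variable [GradedAlgebra 𝒜]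

/-- The graded right `A`-module `A(n)`, with `A(n)_i = A_{n+i}`. -/
def regularShift (n : ℤ) : RightGrMod 𝒜 where
  carrier := A
  deg i := (𝒜 (n + i)).toAddSubgroup
  isInternal := by
    refine isInternal_of_components _
      (fun i => (GradedRing.proj 𝒜 (n + i))) ?_ ?_ ?_
    · intro i x hx
      exact DirectSum.decompose_of_mem_same 𝒜 hx
    · intro i j x hij hx
      exact DirectSum.decompose_of_mem_ne 𝒜 hx (by lia)
    · intro x
      classical
      rw [← DirectSum.sum_support_decompose 𝒜 x]
      refine sum_mem fun i _ => AddSubgroup.mem_iSup_of_mem (i - n) ?_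
      change _ ∈ 𝒜 (n + (i - n))
      rw [add_sub_cancel]
      exact Subtype.property _
  smul_mem := by
    rintro i j _ m ⟨a, ha, rfl⟩ hm
    change m * a ∈ 𝒜 (n + (i + j))
    rw [show n + (i + j) = (n + j) + i by ring]
    exact SetLike.mul_mem_graded hm ha
  finite := ⟨⟨{1}, by
    rw [Finset.coe_singleton, Submodule.eq_top_iff']
    intro x
    exact Submodule.mem_span_singleton.2 ⟨MulOpposite.op x, by simp⟩⟩⟩

/-- Left multiplication by an element `a` of degree `m`, as a morphism `A(j) ⟶ A(j')` of graded
right modules, where `j' = m + j`. -/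
def leftMul {m j j' : ℤ} (a : A) (ha : a ∈ 𝒜 m) (h : m + j = j') :
    regularShift 𝒜 j ⟶ regularShift 𝒜 j' :=
  GrMod.ofLin
    ({ toFun := fun x : A => a * x
       map_add' := mul_add a
       map_smul' := fun r x => by
        change a * (x * r.unop) = a * x * r.unop
        rw [mul_assoc] } : A →ₗ[Aᵐᵒᵖ] A) (by
      intro i x hx
      change a * (show A from x) ∈ 𝒜 (j' + i)
      rw [← h, add_assoc]
      exact SetLike.mul_mem_graded ha hx)

variable [IsNoetherianRing Aᵐᵒᵖ]

/-- `Ext^n_A(M, A) ≅ S(p)` as graded left `A`-modules. Here the degree `j` part of `Ext^n_A(M, A)`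
is the group `Ext^n(M, A(j))` in the category of finitely generated graded right modules, and the
left multiplications `A(j) ⟶ A(m + j)` make `⨁ j, Ext^n(M, A(j))` a graded left `A`-module. -/
def ExtIsoShift (M : RightGrMod 𝒜) (n : ℕ) (S : LeftGrMod 𝒜) (p : ℤ) : Prop :=
  ∃ φ : ∀ j : ℤ, Abelian.Ext M (regularShift 𝒜 j) n ≃+ S.deg (p + j),
    ∀ {m j j' : ℤ} (a : A) (ha : a ∈ 𝒜 m) (h : m + j = j')
      (x : Abelian.Ext M (regularShift 𝒜 j) n),
      (φ j' (x.comp (Abelian.Ext.mk₀ (leftMul 𝒜 a ha h)) (add_zero n)) : S) = a • (φ j x : S)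

variable [IsNoetherianRing A]

/-- `ℕ`-graded Artin-Schelter Gorenstein algebras of dimension `d`: Noetherian, locally finite,
`ℕ`-graded algebras `A` of injective dimension `d` on both sides such that for each simple graded
right module `S` concentrated in degree `0`, the graded left module `Ext^n_A(S, A)` vanishes
for `n ≠ d` and for `n = d` is a degree shift of a simple graded left module concentrated in
degree `0`. -/
structure IsNatGradedASGorenstein (d : ℕ) : Prop where
  natGraded : ∀ i : ℤ, i < 0 → 𝒜 i = ⊥
  locallyFinite : ∀ i : ℤ, FiniteDimensional k (𝒜 i)
  injectiveDimension_right : injectiveDimension (ModuleCat.of Aᵐᵒᵖ A) = d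
  injectiveDimension_left : injectiveDimension (ModuleCat.of A A) = d
  ext_eq_zero : ∀ S : RightGrMod 𝒜, Simple S → S.IsConcentratedInDegreeZero →
    ∀ n : ℕ, n ≠ d → ∀ j : ℤ, Subsingleton (Abelian.Ext S (regularShift 𝒜 j) n)
  ext_iso : ∀ S : RightGrMod 𝒜, Simple S → S.IsConcentratedInDegreeZero →
    ∃ (S' : LeftGrMod 𝒜) (p : ℤ), Simple S' ∧ S'.IsConcentratedInDegreeZero ∧
      ExtIsoShift 𝒜 S d S' p

end Regular

section Singularity

variable [IsNoetherianRing Aᵐᵒᵖ]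

/-- The objects of the derived category that are finite length modules or (finitely generated)
projective graded modules, placed in degree `0`. -/
def finiteLengthOrProjective : ObjectProperty (DerivedCategory (RightGrMod 𝒜)) := fun X =>
  ∃ M : RightGrMod 𝒜, (IsFiniteLength Aᵐᵒᵖ M ∨ Projective M) ∧
    X = (DerivedCategory.singleFunctor (RightGrMod 𝒜) 0).obj M

instance : (finiteLengthOrProjective 𝒜).Nonempty :=
  ⟨⟨_, GrMod.zero _, Or.inl (by
    have : Subsingleton (GrMod.zero (opGrading 𝒜)) := inferInstanceAs (Subsingleton PUnit)
    exact .of_subsingleton), rfl⟩⟩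

/-- The thick subcategory `thick {mod₀ A, proj A}` of the derived category of finitely generated
graded right modules. It is contained in the bounded derived category, since the bounded derived
category is thick and contains all modules. -/
def thickFiniteLengthProj : ObjectProperty (DerivedCategory (RightGrMod 𝒜)) :=
  (finiteLengthOrProjective 𝒜).triangEnvelope

instance : (thickFiniteLengthProj 𝒜).IsTriangulated :=
  inferInstanceAs ((finiteLengthOrProjective 𝒜).triangEnvelope.IsTriangulated)

/-- `K^b(proj A)` as a subcategory of `thick {mod₀ A, proj A}`. -/
def perfectInThick : ObjectProperty (thickFiniteLengthProj 𝒜).FullSubcategory :=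
  (perfectComplexes (RightGrMod 𝒜)).inverseImage (thickFiniteLengthProj 𝒜).ι

instance : (perfectInThick 𝒜).IsTriangulated :=
  inferInstanceAs
    (((perfectComplexes (RightGrMod 𝒜)).inverseImage (thickFiniteLengthProj 𝒜).ι).IsTriangulated)

/-- The category `D_{sg,0}(A)`: the Verdier quotient of `thick {mod₀ A, proj A}` by
`K^b(proj A)`. -/
abbrev DsgZero := (perfectInThick 𝒜).trW.Localization

end Singularity

/-- A ring has finite (left) global dimension if the projective dimensions of its modules are
bounded. -/
def HasFiniteGlobalDimension (R : Type u) [Ring R] : Prop :=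
  ∃ n : ℕ, ∀ M : ModuleCat.{u} R, HasProjectiveDimensionLE M n

end GradedAlgebras

/-! Let J be the Jacobson radical of A_0 and let G be A_0/J, viewed as a graded right A-module
concentrated in degree 0. The argument bounds the degrees in which Ext_A(G, G) can be nonzero and
then transfers this bound to A_0.

A silting object forces Hom(X, Y[i]) = 0 for i large, for every pair X, Y: each of the two
conditions on one variable defines a thick subcategory (`IsSilting.homEventuallyZero`). This is
applied to G in the singularity category. To return to Ext over A, suppose that a class in Ext^i(G,
G) dies in the quotient, so that it factors through a bounded complex K of projectives. The
Gorenstein condition gives Ext^j(G, P) = 0 for P projective and j > d, so G → K lifts to the part of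
K in degrees ≥ -d. If i > d, that part has no nonzero map to G[i], which sits in degree -i
(`comp_eq_zero_of_perfectComplexes`). Hence Ext^i(G, G) = 0 for all large i. Every simple A_0-module
is a summand of G, so Ext^i(G, N) = 0 for all i > n and all finitely generated A_0-modules N, with
one common n.

Finally, since A is nonnegatively graded, G has a resolution by sums of A(-m) with m ≥ 0. Its degree
0 part is a resolution of A_0/J by projective A_0-modules, and the vanishing of Ext makes the degree
0 part of the n-th syzygy projective (`hasProjectiveDimensionLT_degZero`). So A_0/J has projective
dimension at most n. As A_0 is Artinian, the same bound holds for all its modules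
(`hasProjectiveDimensionLT_of_quotient_jacobson`). -/

/-! ### Eventual vanishing of Hom in triangulated categories -/

section EventualOrthogonality

open Pretriangulated

variable {C : Type*} [Category* C] [HasZeroObject C] [HasShift C ℤ] [Preadditive C]
  [∀ n : ℤ, (shiftFunctor C n).Additive] [Pretriangulated C]

/-- `Hom(X, Y[i])` vanishes for all sufficiently large `i`. -/
def HomEventuallyZero (X Y : C) : Prop :=
  ∃ n : ℤ, ∀ i, n ≤ i → ∀ f : X ⟶ Y⟦i⟧, f = 0

instance (X : C) : ObjectProperty.IsStableUnderRetracts (HomEventuallyZero X) where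
  of_retract := by
    rintro Y Z r ⟨n, hn⟩
    refine ⟨n, fun i hi f => ?_⟩
    rw [← cancel_mono (r.i⟦i⟧'), zero_comp]
    exact hn i hi _

instance (Y : C) : ObjectProperty.IsStableUnderRetracts (HomEventuallyZero · Y) where
  of_retract := by
    rintro X Z r ⟨n, hn⟩
    refine ⟨n, fun i hi f => ?_⟩
    rw [← cancel_epi r.r, comp_zero]
    exact hn i hi _

/-- The long exact Hom sequence bounds the middle term of a triangle by the maximum of the outer
bounds. The bound may depend on the object, which is what lets the property survive shifts. -/
instance (X : C) : ObjectProperty.IsTriangulated (HomEventuallyZero X) where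
  exists_zero := ⟨_, isZero_zero C, 0, fun i _ f =>
    ((shiftFunctor C i).map_isZero (isZero_zero C)).eq_of_tgt _ _⟩
  isStableUnderShiftBy a := ⟨by
    rintro Y ⟨n, hn⟩
    refine ⟨n - a, fun i hi f => ?_⟩
    rw [← cancel_mono ((shiftFunctorAdd' C a i (a + i) rfl).inv.app Y), zero_comp]
    exact hn _ (by lia) _⟩
  toIsTriangulatedClosed₂ := by
    refine .mk' ?_
    rintro T hT ⟨n, hn⟩ ⟨m, hm⟩
    refine ⟨max n m, fun i hi f => ?_⟩
    obtain ⟨g, rfl⟩ := Triangle.coyoneda_exact₂ _ (Triangle.shift_distinguished T hT i) f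
      (hm i (by lia) _)
    rw [show g = 0 from hn i (by lia) g]
    exact zero_comp

instance (Y : C) : ObjectProperty.IsTriangulated (HomEventuallyZero · Y) where
  exists_zero := ⟨_, isZero_zero C, 0, fun i _ f => (isZero_zero C).eq_of_src _ _⟩
  isStableUnderShiftBy a := ⟨by
    rintro X ⟨n, hn⟩
    refine ⟨n + a, fun i hi f => (shiftFunctor C (-a)).map_injective ?_⟩
    rw [← cancel_mono ((shiftFunctorAdd' C i (-a) (i + -a) rfl).inv.app Y),
      ← cancel_epi ((shiftFunctorCompIsoId C a (-a) (by simp)).inv.app X)]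
    simp only [Functor.map_zero, zero_comp, comp_zero]
    exact hn _ (by lia) _⟩
  toIsTriangulatedClosed₂ := by
    refine .mk' ?_
    rintro T hT ⟨n, hn⟩ ⟨m, hm⟩
    refine ⟨max n m, fun i hi f => ?_⟩
    obtain ⟨g, rfl⟩ := Triangle.yoneda_exact₂ _ hT f (hn i (by lia) _)
    rw [show g = 0 from hm i (by lia) g]
    exact comp_zero

/-- In a triangulated category with a silting object, `Hom(X, Y[i])` vanishes for large `i`. -/
theorem IsSilting.homEventuallyZero {T : C} (hT : IsSilting T) (X Y : C) :
    HomEventuallyZero X Y := by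
  -- Used twice: first in the second variable with source `T`, where the silting condition starts
  -- the dévissage, then in the first variable with `Y` fixed.
  have key : ∀ Q : ObjectProperty C, [Q.IsStableUnderRetracts] → [Q.IsTriangulated] → Q T →
      ∀ Z, Q Z := by
    intro Q _ _ hQ Z
    have h : (ObjectProperty.singleton T).triangEnvelope ≤ Q := by
      rw [ObjectProperty.triangEnvelope_le_iff]
      rintro _ ⟨⟩
      exact hQ
    exact h Z ((hT.2 : _ = ⊤) ▸ trivial)
  have h₁ : ∀ Z, HomEventuallyZero T Z := key (HomEventuallyZero T) ⟨1, hT.1⟩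
  exact key (HomEventuallyZero · Y) (h₁ Y) X

/-- A morphism that becomes zero in a Verdier quotient factors through the subcategory. -/
theorem exists_factorization_of_map_eq_zero [IsTriangulated C] (P : ObjectProperty C)
    [P.IsTriangulated] {D : Type*} [Category* D] [HasZeroMorphisms D] (L : C ⥤ D)
    [L.PreservesZeroMorphisms]
    [L.IsLocalization P.trW] {X Y : C} (f : X ⟶ Y) (hf : L.map f = 0) :
    ∃ (Z : C) (a : X ⟶ Z) (b : Z ⟶ Y), P Z ∧ a ≫ b = f := by
  -- By the calculus of fractions `f` is killed by some `s : W ⟶ X` whose cone `Z` lies in `P`;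
  -- therefore `f` factors through `X ⟶ Z`.
  rw [← L.map_zero, MorphismProperty.map_eq_iff_precomp L P.trW] at hf
  obtain ⟨W, s, ⟨Z, a, c, hT, hZ⟩, h⟩ := hf
  obtain ⟨b, hb⟩ := Triangle.yoneda_exact₂ _ hT f (h.trans comp_zero)
  exact ⟨Z, a, b, hZ, hb.symm⟩

end EventualOrthogonality

/-! ### Morphisms through bounded complexes of projectives -/

section PerfectComplexes

open Pretriangulated DerivedCategory HomologicalComplex

variable {C : Type*} [Category* C] [Abelian C]

/-- The projection of a bounded below complex onto its lowest term. -/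
noncomputable def toLowestTerm (K : CochainComplex C ℤ) (a : ℤ) (ha : ∀ n, n < a → IsZero (K.X n)) :
    K ⟶ (HomologicalComplex.single C (.up ℤ) a).obj (K.X a) :=
  mkHomToSingle (𝟙 _) fun i hi => (ha i (by simp at hi; lia)).eq_of_src _ _

/-- The projection is an isomorphism in degree `a` and has zero target elsewhere, so its kernel is
the brutal truncation of `K` to degrees above `a`. This is the step by which a bounded complex of
projectives is shortened from below. -/
theorem exists_kernel_toLowestTerm {K : CochainComplex C ℤ} {a b : ℤ}
    (hP : ∀ n, Projective (K.X n)) (hK : ∀ n, n < a ∨ b < n → IsZero (K.X n)) :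
    ∃ S : ShortComplex (CochainComplex C ℤ), S.ShortExact ∧ S.X₂ = K ∧
      S.X₃ = (HomologicalComplex.single C (.up ℤ) a).obj (K.X a) ∧
      (∀ n, Projective (S.X₁.X n)) ∧ ∀ n, n < a + 1 ∨ b < n → IsZero (S.X₁.X n) := by
  let p := toLowestTerm K a fun n hn => hK n (Or.inl hn)
  have hp : IsIso (p.f a) := by
    dsimp only [p, toLowestTerm]
    rw [mkHomToSingle_f, Category.id_comp]
    infer_instance
  have hz : ∀ n, n ≠ a → IsZero (((single C (.up ℤ) a).obj (K.X a)).X n) := fun n hn =>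
    isZero_single_obj_X _ _ _ _ hn
  have : Epi p := by
    refine @epi_of_epi_f _ _ _ _ _ _ _ p fun n => ?_
    by_cases hn : n = a
    · subst hn
      infer_instance
    · exact ⟨fun _ _ _ => (hz n hn).eq_of_src _ _⟩
  let S := ShortComplex.mk (kernel.ι p) p (kernel.condition p)
  have hS : S.ShortExact :=
    { exact := ShortComplex.exact_of_f_is_kernel _ (kernelIsKernel p)
      mono_f := inferInstanceAs (Mono (kernel.ι p))
      epi_g := this }
  have hS' := fun n => (shortExact_iff_degreewise_shortExact S).1 hS n
  have h₁ : IsZero (S.X₁.X a) := by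
    have : Mono (S.f.f a) := (hS' a).mono_f
    have hf : S.f.f a ≫ p.f a = 0 := (S.map (eval C (.up ℤ) a)).zero
    have hf' : S.f.f a = 0 := (cancel_mono (p.f a)).1 (hf.trans zero_comp.symm)
    rw [IsZero.iff_id_eq_zero, ← cancel_mono (S.f.f a), hf', comp_zero, comp_zero]
  have h₂ : ∀ n, n ≠ a → Nonempty (S.X₁.X n ≅ K.X n) := fun n hn => by
    have : Mono (S.f.f n) := (hS' n).mono_f
    have : Epi (S.f.f n) := (hS' n).exact.epi_f ((hz n hn).eq_of_tgt _ _)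
    have : IsIso (S.f.f n) := isIso_of_mono_of_epi _
    exact ⟨asIso (S.f.f n)⟩
  refine ⟨S, hS, rfl, rfl, fun n => ?_, fun n hn => ?_⟩
  · by_cases hn : n = a
    · subst hn
      exact h₁.projective
    · obtain ⟨e⟩ := h₂ n hn
      have := hP n
      exact Projective.of_iso e.symm this
  · by_cases hna : n = a
    · subst hna
      exact h₁
    · obtain ⟨e⟩ := h₂ n hna
      exact (hK n (by lia)).of_iso e

variable [HasDerivedCategory C]

/-- Out of a K-projective complex, every morphism of the derived category is represented by a chain
map. -/
theorem Q_hom_eq_zero_of_isKProjective {K L : CochainComplex C ℤ} [K.IsKProjective]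
    (h : ∀ φ : K ⟶ L, φ = 0) (f : Q.obj K ⟶ Q.obj L) : f = 0 := by
  obtain ⟨g, hg⟩ := (CochainComplex.IsKProjective.Qh_map_bijective K
    ((HomotopyCategory.quotient _ _).obj L)).2
      ((quotientCompQhIso C).hom.app K ≫ f ≫ (quotientCompQhIso C).inv.app L)
  obtain ⟨φ, rfl⟩ := (HomotopyCategory.quotient _ _).map_surjective g
  have : (quotientCompQhIso C).hom.app K ≫ f ≫ (quotientCompQhIso C).inv.app L = 0 := by
    rw [← hg, h φ, Functor.map_zero, Functor.map_zero]
  rwa [← cancel_epi ((quotientCompQhIso C).hom.app K),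
    ← cancel_mono ((quotientCompQhIso C).inv.app L), comp_zero, zero_comp, Category.assoc]

theorem to_singleFunctor_eq_zero_of_isKProjective {K : CochainComplex C ℤ} [K.IsKProjective]
    {X : C} {n : ℤ} (hK : IsZero (K.X n)) (f : Q.obj K ⟶ (singleFunctor C n).obj X) : f = 0 :=
  Q_hom_eq_zero_of_isKProjective (L := (CochainComplex.singleFunctor C n).obj X)
    (fun _ => to_single_hom_ext (hK.eq_of_src _ _)) f

variable [HasExt C]

/-- If `Ext^j(S, P) = 0` for `P` projective and `j > d`, then a morphism `S ⟶ S'[i]` with `i > d`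
that factors through a perfect complex vanishes. -/
theorem comp_eq_zero_of_perfectComplexes {S S' : C} {d : ℕ}
    (hS : ∀ P : C, Projective P → ∀ j, d < j → ∀ e : Abelian.Ext S P j, e = 0)
    {i : ℕ} (hi : d < i) {Z : DerivedCategory C} (hZ : perfectComplexes C Z)
    (f : (singleFunctor C 0).obj S ⟶ Z) (g : Z ⟶ ((singleFunctor C 0).obj S')⟦(i : ℤ)⟧) :
    f ≫ g = 0 := by
  -- `P` placed in degree `a` is `P[-a]`, so `u` is a class in Ext^{-a}(S, P) with -a > d.
  have hsingle : ∀ (P : C) (a : ℤ), Projective P → a < -d →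
      ∀ u : (singleFunctor C 0).obj S ⟶ (singleFunctor C a).obj P, u = 0 := by
    intro P a hP ha u
    obtain ⟨j, hj⟩ := Int.eq_ofNat_of_zero_le (a := -a) (by lia)
    let e := ((singleFunctors C).shiftIso (j : ℤ) a 0 (by lia)).app P
    rw [← cancel_mono e.inv, zero_comp]
    obtain ⟨x, hx⟩ := (Abelian.Ext.homEquiv (X := S) (Y := P) (n := j)).surjective (u ≫ e.inv)
    rw [← hx, hS P hP j (by lia) x]
    exact Abelian.Ext.zero_hom _ _ _
  obtain ⟨K, ⟨hP, a, b, hK⟩, ⟨e⟩⟩ := hZ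
  -- Induction on `n`, a bound for how far `K` reaches below degree -d. For n = 0 the complex starts
  -- in degree ≥ -d and `S'[i]` sits in degree -i < -d, so already `g` vanishes.
  suffices h : ∀ (n : ℕ) (K : CochainComplex C ℤ) (a b : ℤ), -(d : ℤ) ≤ a + n →
      (∀ n, Projective (K.X n)) → (∀ n, n < a ∨ b < n → IsZero (K.X n)) →
      ∀ (f : (singleFunctor C 0).obj S ⟶ Q.obj K)
        (g : Q.obj K ⟶ ((singleFunctor C 0).obj S')⟦(i : ℤ)⟧), f ≫ g = 0 by
    have := h (-(d : ℤ) - a).toNat K a b (by lia) hP hK (f ≫ e.inv) (e.hom ≫ g)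
    simpa using this
  intro n
  induction n with
  | zero =>
    intro K a b ha hP hK f g
    have := IsBoundedProjective.isKProjective (K := K) ⟨hP, a, b, hK⟩
    let e := ((singleFunctors C).shiftIso (i : ℤ) (-i) 0 (by lia)).app S'
    have : g = 0 := by
      rw [← cancel_mono e.hom, zero_comp]
      exact to_singleFunctor_eq_zero_of_isKProjective (hK _ (by lia)) _
    rw [this, comp_zero]
  | succ n ih =>
    intro K a b ha hP hK f g
    by_cases had : -(d : ℤ) ≤ a + n
    · exact ih K a b had hP hK f g
    -- Here a < -d, so the component of `f` at the lowest term vanishes by `hsingle` and `f` lifts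
    -- to the truncation, which starts one degree higher.
    obtain ⟨T, hT, rfl, hT₃, hT₁, hT₁'⟩ := exists_kernel_toLowestTerm hP hK
    obtain ⟨f', rfl⟩ := Triangle.coyoneda_exact₂ _ (triangleOfSES_distinguished hT) f (by
      change f ≫ Q.map T.g = 0
      -- The target is a variable so that the equality `hT₃` can be eliminated by substitution.
      have : ∀ (X : CochainComplex C ℤ) (p : T.X₂ ⟶ X),
          X = (single C (.up ℤ) a).obj (T.X₂.X a) → f ≫ Q.map p = 0 := by
        rintro X p rfl
        exact hsingle _ a (hP a) (by lia) _
      exact this _ _ hT₃)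
    exact (Category.assoc _ _ _).trans (ih T.X₁ (a + 1) b (by lia) hT₁ hT₁' f' (Q.map T.f ≫ g))

end PerfectComplexes

/-! ### From the singularity category back to Ext -/

section SingularityCategory

open DerivedCategory

variable {k : Type v} [Field k] {A : Type u} [Ring A] [Algebra k A] (𝒜 : ℤ → Submodule k A)
  [IsNoetherianRing Aᵐᵒᵖ]

/-- If the singularity category has a silting object, then `Ext^i(S, S')` vanishes for large `i`
when `S` and `S'` have finite length and `Ext^j(S, -)` vanishes on projectives for `j > d`. -/
theorem exists_forall_ext_eq_zero_of_silting {T : DsgZero 𝒜} (hT : IsSilting T) {d : ℕ}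
    {S S' : RightGrMod 𝒜} (hlen : IsFiniteLength Aᵐᵒᵖ S) (hlen' : IsFiniteLength Aᵐᵒᵖ S')
    (hS : ∀ P : RightGrMod 𝒜, Projective P → ∀ j, d < j → ∀ e : Abelian.Ext S P j, e = 0) :
    ∃ n : ℕ, ∀ i, n ≤ i → ∀ e : Abelian.Ext S S' i, e = 0 := by
  have hmem : ∀ M : RightGrMod 𝒜, IsFiniteLength Aᵐᵒᵖ M →
      thickFiniteLengthProj 𝒜 ((singleFunctor (RightGrMod 𝒜) 0).obj M) := fun M hM =>
    (finiteLengthOrProjective 𝒜).le_triangEnvelope _ ⟨M, Or.inl hM, rfl⟩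
  let X : (thickFiniteLengthProj 𝒜).FullSubcategory := ⟨_, hmem S hlen⟩
  let Y : (thickFiniteLengthProj 𝒜).FullSubcategory := ⟨_, hmem S' hlen'⟩
  let L := (perfectInThick 𝒜).trW.Q
  obtain ⟨n, hn⟩ := hT.homEventuallyZero (L.obj X) (L.obj Y)
  -- The bound `n` kills the image of `e` in the quotient; i > d is what makes passage to the
  -- quotient injective on such classes.
  refine ⟨max n.toNat (d + 1), fun i hi e => ?_⟩
  apply Abelian.Ext.homEquiv.injective
  refine Eq.trans ?_ (Abelian.Ext.zero_hom _ _ _).symm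
  let c := ((thickFiniteLengthProj 𝒜).ι.commShiftIso (i : ℤ)).app Y
  let f : X ⟶ Y⟦(i : ℤ)⟧ := ObjectProperty.homMk
    (Abelian.Ext.homEquiv e ≫ (c.inv : ((singleFunctor (RightGrMod 𝒜) 0).obj S')⟦(i : ℤ)⟧ ⟶ _))
  have hf : L.map f = 0 := by
    rw [← cancel_mono ((L.commShiftIso (i : ℤ)).hom.app Y), zero_comp]
    exact hn i (by lia) _
  obtain ⟨Z, a, b, hZ, hab⟩ := exists_factorization_of_map_eq_zero (perfectInThick 𝒜) L f hf
  have h : a.hom ≫ b.hom = Abelian.Ext.homEquiv e ≫ c.inv := congrArg (fun g => g.hom) hab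
  rw [← cancel_mono c.inv, zero_comp]
  refine h.symm.trans ?_
  rw [← cancel_mono c.hom, zero_comp, Category.assoc]
  exact comp_eq_zero_of_perfectComplexes hS (by lia) hZ a.hom (b.hom ≫ c.hom)

end SingularityCategory

/-! ### Projective dimension over semiprimary rings -/

section ModuleProjectiveDimension

variable {R : Type u} [Ring R]

theorem moduleCat_shortExact_of_exact {M N P : Type u} [AddCommGroup M] [Module R M]
    [AddCommGroup N] [Module R N] [AddCommGroup P] [Module R P] (f : M →ₗ[R] N) (g : N →ₗ[R] P)
    (hf : Function.Injective f) (hg : Function.Surjective g) (h : Function.Exact f g) :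
    (ShortComplex.mk (ModuleCat.ofHom f) (ModuleCat.ofHom g) (by
      ext x; exact h.apply_apply_eq_zero x)).ShortExact :=
  ModuleCat.shortComplex_shortExact _ h hf hg

theorem moduleCat_shortExact_of_exact_finsupp (ι : Type u) {M N P : Type u} [AddCommGroup M]
    [Module R M] [AddCommGroup N] [Module R N] [AddCommGroup P] [Module R P] (f : M →ₗ[R] N)
    (g : N →ₗ[R] P) (hf : Function.Injective f) (hg : Function.Surjective g)
    (h : Function.Exact f g) :
    (ShortComplex.mk (ModuleCat.ofHom (Finsupp.mapRange.linearMap (α := ι) f))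
      (ModuleCat.ofHom (Finsupp.mapRange.linearMap (α := ι) g)) (by
        ext x a
        simp [h.apply_apply_eq_zero])).ShortExact :=
  moduleCat_shortExact_of_exact (M := ι →₀ M) (N := ι →₀ N) (P := ι →₀ P)
    (Finsupp.mapRange.linearMap f) (Finsupp.mapRange.linearMap g)
    (Finsupp.mapRange_injective _ (map_zero _) hf) (Finsupp.mapRange_surjective _ (map_zero _) hg)
    (by rw [LinearMap.exact_iff, Finsupp.ker_mapRange, Finsupp.range_mapRange_linearMap _
      (LinearMap.ker_eq_bot.2 hf), LinearMap.exact_iff.1 h])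

theorem hasProjectiveDimensionLT_of_linear_retract {M N : Type u} [AddCommGroup M] [Module R M]
    [AddCommGroup N] [Module R N] (i : M →ₗ[R] N) (r : N →ₗ[R] M) (h : r ∘ₗ i = LinearMap.id)
    (n : ℕ) [HasProjectiveDimensionLT (ModuleCat.of R N) n] :
    HasProjectiveDimensionLT (ModuleCat.of R M) n :=
  Retract.hasProjectiveDimensionLT (Y := ModuleCat.of R N)
    ⟨ModuleCat.ofHom i, ModuleCat.ofHom r, by
      rw [← ModuleCat.ofHom_comp, h]; rfl⟩ n

theorem hasProjectiveDimensionLT_one_of_projective (M : Type u) [AddCommGroup M] [Module R M]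
    [Module.Projective R M] : HasProjectiveDimensionLT (ModuleCat.of R M) 1 := by
  have := (IsProjective.iff_projective M).1 ‹_›
  infer_instance

/-- Dimension shifting along the free cover of `N`: direct sums are exact and preserve projectives.
The recursion bottoms out at zero modules (n = 0) and projective modules (n = 1). Infinite `ι` is
needed because arbitrary modules are treated later. -/
theorem hasProjectiveDimensionLT_finsupp (ι : Type u) (n : ℕ) : ∀ (N : Type u) [AddCommGroup N]
    [Module R N], HasProjectiveDimensionLT (ModuleCat.of R N) n →
    HasProjectiveDimensionLT (ModuleCat.of R (ι →₀ N)) n := by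
  have hcover : ∀ (N : Type u) [AddCommGroup N] [Module R N],
      Function.Surjective (Finsupp.linearCombination R (id : N → N)) := fun N _ _ =>
    Finsupp.linearCombination_id_surjective R N
  match n with
  | 0 =>
    intro N _ _ h
    rw [hasProjectiveDimensionLT_zero_iff_isZero] at h ⊢
    have : Subsingleton N := ModuleCat.subsingleton_of_isZero h
    exact @ModuleCat.isZero_of_subsingleton _ _ _ (inferInstanceAs (Subsingleton (ι →₀ N)))
  | 1 =>
    intro N _ _ h
    have : Projective (ModuleCat.of R N) := inferInstance
    have : Module.Projective R N := (IsProjective.iff_projective N).2 this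
    have : Module.Projective R (ι →₀ N) := by
      classical exact .of_equiv (finsuppLequivDFinsupp R).symm
    exact hasProjectiveDimensionLT_one_of_projective _
  | n + 2 =>
    intro N _ _ h
    obtain ⟨K, _, _, i, hi, h'⟩ : ∃ (K : Type u) (_ : AddCommGroup K) (_ : Module R K)
        (i : K →ₗ[R] (N →₀ R)), Function.Injective i ∧
          Function.Exact i (Finsupp.linearCombination R (id : N → N)) :=
      ⟨LinearMap.ker (Finsupp.linearCombination R (id : N → N)), inferInstance, inferInstance,
        Submodule.subtype _, Subtype.val_injective, LinearMap.exact_subtype_ker_map _⟩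
    have hS := moduleCat_shortExact_of_exact i _ hi (hcover N) h'
    have hS' := moduleCat_shortExact_of_exact_finsupp ι i _ hi (hcover N) h'
    have hP := (IsProjective.iff_projective (R := R) (N →₀ R)).1 inferInstance
    have hP' := (IsProjective.iff_projective (R := R) (ι →₀ N →₀ R)).1 inferInstance
    rw [hS'.hasProjectiveDimensionLT_X₃_iff n hP']
    exact hasProjectiveDimensionLT_finsupp ι (n + 1) _
      ((hS.hasProjectiveDimensionLT_X₃_iff n hP).1 h)

instance [IsSemiprimaryRing R] : IsSemisimpleModule R (R ⧸ Ring.jacobson R) :=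
  (LinearMap.isSemisimpleModule_iff_of_bijective
    ({ toFun := id
       map_add' := fun _ _ => rfl
       map_smul' := fun r x => by
        obtain ⟨x, rfl⟩ := Ideal.Quotient.mk_surjective x
        rfl } : (R ⧸ Ring.jacobson R) →ₛₗ[Ideal.Quotient.mk (Ring.jacobson R)]
          (R ⧸ Ring.jacobson R)) Function.bijective_id).2 inferInstance

/-- The map `R ⧸ J ⟶ M`, `r ↦ r • m` for a module annihilated by the Jacobson radical `J`. -/
def quotientJacobsonSMul {M : Type u} [AddCommGroup M] [Module R M]
    (hM : Module.IsTorsionBySet R M (Ring.jacobson R)) (m : M) :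
    (R ⧸ Ring.jacobson R) →ₗ[R] M :=
  (Ring.jacobson R).liftQ (LinearMap.toSpanSingleton R M m) fun r hr =>
    LinearMap.mem_ker.2 (@hM m ⟨r, hr⟩)

theorem quotientJacobsonSMul_mk {M : Type u} [AddCommGroup M] [Module R M]
    (hM : Module.IsTorsionBySet R M (Ring.jacobson R)) (m : M) (r : R) :
    quotientJacobsonSMul hM m ((Ring.jacobson R).mkQ r) = r • m := rfl

/-- The radical kills `S`, so a nonzero `s` gives a surjection from R/J onto `S`; it splits since
R/J is semisimple. -/
theorem exists_retract_quotient_jacobson [IsSemiprimaryRing R] (S : Type u) [AddCommGroup S]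
    [Module R S] [IsSimpleModule R S] :
    ∃ (i : S →ₗ[R] R ⧸ Ring.jacobson R) (r : (R ⧸ Ring.jacobson R) →ₗ[R] S),
      r ∘ₗ i = LinearMap.id := by
  have := IsSimpleModule.nontrivial R S
  obtain ⟨s, hs⟩ := exists_ne (0 : S)
  have hS : Module.IsTorsionBySet R S (Ring.jacobson R) := fun m r =>
    Module.mem_annihilator.1 (IsSemisimpleModule.jacobson_le_annihilator R S r.2) m
  obtain ⟨i, hi⟩ := IsSemisimpleModule.lifting_property (quotientJacobsonSMul hS s) (fun x => by
    obtain ⟨r, rfl⟩ := IsSimpleModule.toSpanSingleton_surjective R hs x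
    exact ⟨(Ring.jacobson R).mkQ r, rfl⟩) LinearMap.id
  exact ⟨i, _, hi⟩

/-- Over a semiprimary ring, the projective dimension of every module is bounded by that of
the ring modulo its Jacobson radical. -/
theorem hasProjectiveDimensionLT_of_quotient_jacobson [IsSemiprimaryRing R] (n : ℕ)
    (h : HasProjectiveDimensionLT (ModuleCat.of R (R ⧸ Ring.jacobson R)) n)
    (M : Type u) [AddCommGroup M] [Module R M] :
    HasProjectiveDimensionLT (ModuleCat.of R M) n := by
  refine IsSemiprimaryRing.induction R R M
    (P := fun M [AddCommGroup M] [Module R M] [Module R M] =>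
      HasProjectiveDimensionLT (ModuleCat.of R M) n)
    (fun M _ _ _ _ _ hM => ?_) (fun M _ _ _ _ h₁ h₂ => ?_)
  -- A module killed by J is a quotient, hence by semisimplicity a summand, of a direct sum of
  -- copies of R/J indexed by its own elements. General modules are built from these by extensions.
  · obtain ⟨i, hi⟩ := IsSemisimpleModule.lifting_property
      (Finsupp.lsum ℕ (quotientJacobsonSMul hM)) (fun m =>
        ⟨Finsupp.single m ((Ring.jacobson R).mkQ 1), by
          simp [-Submodule.mkQ_apply, quotientJacobsonSMul_mk]⟩) LinearMap.id
    have := hasProjectiveDimensionLT_finsupp M n _ h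
    exact hasProjectiveDimensionLT_of_linear_retract i _ hi n
  · exact (moduleCat_shortExact_of_exact _ _ (Submodule.injective_subtype _)
      (Submodule.mkQ_surjective _) (LinearMap.exact_subtype_mkQ _)).hasProjectiveDimensionLT_X₂ n
      h₁ h₂

end ModuleProjectiveDimension

/-! ### Direct sums, exactness and projective covers of graded modules -/

namespace GrMod

section Coproducts

variable {k : Type v} [Field k] {R : Type u} [Ring R] [Algebra k R] {𝓡 : ℤ → Submodule k R}

/-- The first inclusion into a direct sum. -/
def inl (M N : GrMod 𝓡) : M ⟶ prod M N :=
  ofLin (LinearMap.inl R M N) fun _ _ h => ⟨h, zero_mem _⟩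

/-- The second inclusion into a direct sum. -/
def inr (M N : GrMod 𝓡) : N ⟶ prod M N :=
  ofLin (LinearMap.inr R M N) fun _ _ h => ⟨zero_mem _, h⟩

/-- The second projection from a direct sum. -/
def snd (M N : GrMod 𝓡) : prod M N ⟶ N := ofLin (LinearMap.snd R M N) fun _ _ h => h.2

/-- The morphism from a direct sum that is given by its restrictions to the summands. -/
def coprod {M N P : GrMod 𝓡} (f : M ⟶ P) (g : N ⟶ P) : prod M N ⟶ P :=
  ofLin ((lin f).coprod (lin g)) fun _ _ h => add_mem (lin_mem f h.1) (lin_mem g h.2)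

theorem coprod_apply {M N P : GrMod 𝓡} (f : M ⟶ P) (g : N ⟶ P) (m : M) (n : N) :
    lin (coprod f g) ((m, n) : M × N) = lin f m + lin g n := rfl

theorem inl_coprod {M N P : GrMod 𝓡} (f : M ⟶ P) (g : N ⟶ P) : inl M N ≫ coprod f g = f :=
  hom_ext' fun m => (coprod_apply f g m 0).trans (by rw [map_zero, add_zero])

theorem inr_coprod {M N P : GrMod 𝓡} (f : M ⟶ P) (g : N ⟶ P) : inr M N ≫ coprod f g = g :=
  hom_ext' fun n => (coprod_apply f g 0 n).trans (by rw [map_zero, zero_add])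

theorem prod_hom_ext {M N P : GrMod 𝓡} {f g : prod M N ⟶ P} (h₁ : inl M N ≫ f = inl M N ≫ g)
    (h₂ : inr M N ≫ f = inr M N ≫ g) : f = g :=
  hom_ext (LinearMap.prod_ext (congrArg lin h₁) (congrArg lin h₂))

theorem projective_prod {M N : GrMod 𝓡} (hM : Projective M) (hN : Projective N) :
    Projective (prod M N) where
  factors f e _ :=
    ⟨coprod (Projective.factorThru (inl M N ≫ f) e) (Projective.factorThru (inr M N ≫ f) e),
      prod_hom_ext (by rw [← Category.assoc, inl_coprod, Projective.factorThru_comp])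
        (by rw [← Category.assoc, inr_coprod, Projective.factorThru_comp])⟩

theorem epi_of_surjective {M N : GrMod 𝓡} (f : M ⟶ N) (hf : Function.Surjective (lin f)) :
    Epi f :=
  ⟨fun _ _ hgh => hom_ext' fun n => by
    obtain ⟨m, rfl⟩ := hf n
    exact congrArg (fun φ => lin φ m) hgh⟩

theorem mono_of_injective {M N : GrMod 𝓡} (f : M ⟶ N) (hf : Function.Injective (lin f)) :
    Mono f :=
  ⟨fun _ _ hgh => hom_ext' fun n => hf (congrArg (fun φ => lin φ n) hgh)⟩

end Coproducts

section ShortExact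

variable {k : Type v} [Field k] {R : Type u} [Ring R] [Algebra k R] {𝓡 : ℤ → Submodule k R}
  [IsNoetherianRing R]

/-- Exactness of the underlying modules suffices: an injective morphism reflects homogeneity, so
lifting through `f` preserves degrees automatically. -/
theorem shortExact_of_exact {M N P : GrMod 𝓡} (f : M ⟶ N) (g : N ⟶ P) (w : f ≫ g = 0)
    (hf : Function.Injective (lin f)) (hg : Function.Surjective (lin g))
    (h : Function.Exact (lin f) (lin g)) : (ShortComplex.mk f g w).ShortExact where
  mono_f := mono_of_injective f hf
  epi_g := epi_of_surjective g hg
  exact := by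
    have key : ∀ {Q : GrMod 𝓡} (q : Q ⟶ N), q ≫ g = 0 →
        ∀ x, lin q x ∈ LinearMap.range (lin f) := fun q hq x =>
      (h _).1 (congrArg (fun φ => lin φ x) hq)
    have key' : ∀ {Q : GrMod 𝓡} (q : Q ⟶ N) (hq : q ≫ g = 0) (x : Q),
        lin f ((LinearEquiv.ofInjective (lin f) hf).symm ⟨lin q x, key q hq x⟩) = lin q x :=
      fun q hq x => congrArg Subtype.val
        ((LinearEquiv.ofInjective (lin f) hf).apply_symm_apply ⟨lin q x, key q hq x⟩)
    refine ShortComplex.exact_of_f_is_kernel _ (KernelFork.IsLimit.ofι _ _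
      (fun {Q} q hq => ofLin ((LinearEquiv.ofInjective (lin f) hf).symm.toLinearMap.comp
          ((lin q).codRestrict _ (key q hq))) (fun i x hx => ?_))
      (fun q hq => hom_ext' fun x => key' q hq x)
      (fun q hq m hm => hom_ext' fun x => hf
        ((congrArg (fun φ => lin φ x) hm).trans (key' q hq x).symm)))
    refine mem_deg_of_lin_mem f hf ?_
    exact (key' q hq x).symm ▸ lin_mem q hx

theorem shortExact_ker {M N : GrMod 𝓡} (f : M ⟶ N) (hf : Function.Surjective (lin f)) :
    (ShortComplex.mk (kerι f) f (kerι_comp f)).ShortExact :=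
  shortExact_of_exact _ _ _ Subtype.val_injective hf (LinearMap.exact_subtype_ker_map _)

theorem shortExact_prod (M N : GrMod 𝓡) :
    (ShortComplex.mk (inl M N) (snd M N) (hom_ext' fun _ => rfl)).ShortExact :=
  shortExact_of_exact _ _ _ LinearMap.inl_injective LinearMap.snd_surjective
    Function.Exact.inl_snd

theorem isIso_of_bijective {M N : GrMod 𝓡} (f : M ⟶ N) (hf : Function.Bijective (lin f)) :
    IsIso f := by
  have := mono_of_injective f hf.1
  have := epi_of_surjective f hf.2
  exact isIso_of_mono_of_epi f

end ShortExact

section Covers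

variable {k : Type v} [Field k] {A : Type u} [Ring A] [Algebra k A] {𝒜 : ℤ → Submodule k A}
  [GradedAlgebra 𝒜]

/-- The morphism `A(n) ⟶ M` that sends `1` to a homogeneous element of degree `-n`. -/
def regularShiftHom {M : RightGrMod 𝒜} {n i : ℤ} (h : n + i = 0) (m : M) (hm : m ∈ M.deg i) :
    regularShift 𝒜 n ⟶ M :=
  ofLin
    ({ toFun := fun a : A => MulOpposite.op a • m
       map_add' := fun a b => add_smul _ _ m
       map_smul' := fun r x => by
        change MulOpposite.op (x * r.unop) • m = r • MulOpposite.op x • m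
        rw [← mul_smul]
        rfl } : A →ₗ[Aᵐᵒᵖ] M) (by
      intro j x hx
      have := M.smul_mem (i := n + j) (r := MulOpposite.op (show A from x)) ⟨x, hx, rfl⟩ hm
      rwa [show n + j + i = j by lia] at this)

theorem regularShiftHom_one {M : RightGrMod 𝒜} {n i : ℤ} (h : n + i = 0) (m : M)
    (hm : m ∈ M.deg i) : lin (regularShiftHom h m hm) (1 : A) = m := one_smul Aᵐᵒᵖ m

theorem regularShift_hom_ext {M : RightGrMod 𝒜} {n : ℤ} {f g : regularShift 𝒜 n ⟶ M}
    (h : lin f (1 : A) = lin g (1 : A)) : f = g := by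
  refine hom_ext' fun x => ?_
  have hx : x = (MulOpposite.op (show A from x) • (1 : A) : A) := (one_mul (show A from x)).symm
  rw [hx]
  refine ((lin f).map_smul _ _).trans (Eq.trans ?_ ((lin g).map_smul _ _).symm)
  exact congrArg _ h

theorem one_mem_regularShift {n i : ℤ} (h : n + i = 0) :
    (1 : A) ∈ (regularShift 𝒜 n).deg i := by
  change (1 : A) ∈ 𝒜 (n + i)
  rw [h]
  exact SetLike.GradedOne.one_mem

/-- A morphism out of A(n) amounts to a homogeneous element of degree -n, and such elements lift
homogeneously. -/
instance projective_regularShift (n : ℤ) : Projective (regularShift 𝒜 n) where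
  factors {E X} f e _ := by
    obtain ⟨m, hm⟩ := lin_surjective_of_epi e (lin f (1 : A) : X)
    have h1 : (lin f (1 : A) : X) ∈ X.deg (-n) := 
      lin_mem f (one_mem_regularShift (A := A) (𝒜 := 𝒜) (n := n) (by lia))
    obtain ⟨m', hm', h⟩ := exists_mem_deg e (hm ▸ h1)
    refine ⟨regularShiftHom (by lia) m' hm', regularShift_hom_ext ?_⟩
    exact (congrArg (lin e) (regularShiftHom_one _ m' hm')).trans (h.trans hm)

/-- Every graded module is a quotient of a finite direct sum of modules `A(-i)`. -/
theorem exists_surjection (𝒞 : RightGrMod 𝒜 → Prop) (h₀ : 𝒞 (zero _))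
    (hprod : ∀ P Q, 𝒞 P → 𝒞 Q → 𝒞 (prod P Q)) (M : RightGrMod 𝒜)
    (hM : ∀ i, M.deg i ≠ ⊥ → 𝒞 (regularShift 𝒜 (-i))) :
    ∃ (P : RightGrMod 𝒜) (f : P ⟶ M), 𝒞 P ∧ Function.Surjective (lin f) := by
  classical
  -- Submodules covered by a module in the class `𝒞`. They are closed under finite sums, so it
  -- suffices to cover nonzero homogeneous elements; these only call for A(-i) with M_i ≠ 0.
  let 𝒮 : Submodule Aᵐᵒᵖ M → Prop := fun N =>
    ∃ (P : RightGrMod 𝒜) (f : P ⟶ M), 𝒞 P ∧ N ≤ LinearMap.range (lin f)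
  have hbot : 𝒮 ⊥ := ⟨_, 0, h₀, bot_le⟩
  have hsup : ∀ N N', 𝒮 N → 𝒮 N' → 𝒮 (N ⊔ N') := by
    rintro N N' ⟨P, f, hP, hf⟩ ⟨Q, g, hQ, hg⟩
    exact ⟨_, coprod f g, hprod P Q hP hQ,
      (sup_le_sup hf hg).trans (LinearMap.range_coprod _ _).ge⟩
  have hmem : ∀ m, 𝒮 (Submodule.span _ {m}) := by
    intro m
    obtain ⟨s, hs⟩ := exists_sum_gradedComponent M.isInternal m
    have : 𝒮 (s.sup fun i => Submodule.span _ {M.comp i m}) := by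
      refine Finset.sup_induction hbot (fun N hN N' hN' => hsup N N' hN hN') fun i _ => ?_
      by_cases hi : M.comp i m = 0
      · rwa [hi, Submodule.span_zero_singleton]
      · have hmi : M.comp i m ∈ M.deg i := gradedComponent_mem M.isInternal i m
        refine ⟨_, regularShiftHom (n := -i) (by lia) _ hmi, hM i fun h => hi ?_, ?_⟩
        · rwa [h] at hmi
        · rw [Submodule.span_singleton_le_iff_mem]
          exact ⟨(1 : A), regularShiftHom_one _ _ _⟩
    obtain ⟨P, f, hP, hf⟩ := this
    refine ⟨P, f, hP, le_trans ?_ hf⟩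
    rw [Submodule.span_singleton_le_iff_mem]
    refine Set.mem_of_eq_of_mem (s := ((_ : Submodule Aᵐᵒᵖ M) : Set M)) hs
      (sum_mem fun i hi => Finset.le_sup (f := fun i => Submodule.span Aᵐᵒᵖ {M.comp i m}) hi
      (Submodule.mem_span_singleton_self _))
  obtain ⟨t, ht⟩ := M.finite.fg_top
  have : 𝒮 (t.sup fun m => Submodule.span _ {m}) :=
    Finset.sup_induction hbot (fun N hN N' hN' => hsup N N' hN hN') fun m _ => hmem m
  obtain ⟨P, f, hP, hf⟩ := this
  refine ⟨P, f, hP, LinearMap.range_eq_top.1 (top_le_iff.1 (le_trans ?_ hf))⟩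
  rw [← ht, Submodule.span_le]
  exact fun m hm => Finset.le_sup (f := fun m => Submodule.span Aᵐᵒᵖ {m}) hm
    (Submodule.mem_span_singleton_self _)

/-- If `Ext^n(X, A(j)) = 0` for all `j`, then `Ext^n(X, P) = 0` for all projective `P`. -/
theorem ext_eq_zero_of_projective [IsNoetherianRing Aᵐᵒᵖ] {X : RightGrMod 𝒜} {n : ℕ}
    (hX : ∀ j, ∀ e : Abelian.Ext X (regularShift 𝒜 j) n, e = 0) (P : RightGrMod 𝒜)
    [Projective P] (e : Abelian.Ext X P n) : e = 0 := by
  obtain ⟨Q, f, hQ, hf⟩ := exists_surjection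
    (fun Q : RightGrMod 𝒜 => ∀ e : Abelian.Ext X Q n, e = 0)
    (fun e => by
      have : Subsingleton (zero (opGrading 𝒜)) := inferInstanceAs (Subsingleton PUnit)
      rw [← e.comp_mk₀_id, (IsZero.iff_id_eq_zero _).1 (isZero_of_subsingleton _),
        Abelian.Ext.mk₀_zero, Abelian.Ext.comp_zero])
    (fun P Q hP hQ e => by
      obtain ⟨e', rfl⟩ := Abelian.Ext.covariant_sequence_exact₂ X (shortExact_prod P Q) e (hQ _)
      rw [hP e', Abelian.Ext.zero_comp]) P fun i _ => hX (-i)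
  -- Being projective, `P` is a retract of `Q`, a finite direct sum on which Ext^n(X, -) vanishes.
  have := epi_of_surjective f hf
  rw [← e.comp_mk₀_id, ← Projective.factorThru_comp (𝟙 P) f, ← Abelian.Ext.mk₀_comp_mk₀,
    ← Abelian.Ext.comp_assoc_of_second_deg_zero, hQ (e.comp _ _), Abelian.Ext.zero_comp]

end Covers

end GrMod

/-! ### Degree 0 parts and inflation along A → A_0 -/

section DegreeZero

variable {k : Type v} [Field k] {A : Type u} [Ring A] [Algebra k A] {𝒜 : ℤ → Submodule k A}

theorem GrMod.induction_homogeneous (M : RightGrMod 𝒜) {p : M → Prop} (h₀ : p 0)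
    (hadd : ∀ m n, p m → p n → p (m + n)) (hmem : ∀ i, ∀ m ∈ M.deg i, p m) (m : M) : p m := by
  obtain ⟨s, hs⟩ := exists_sum_gradedComponent M.isInternal m
  rw [hs]
  exact Finset.sum_induction _ p hadd h₀ fun i _ => hmem i _ (gradedComponent_mem _ _ _)

/-- The element of `Aᵐᵒᵖ` given by an element of `(𝒜 0)ᵐᵒᵖ`. -/
def opIncl (r : (𝒜 0)ᵐᵒᵖ) : Aᵐᵒᵖ := MulOpposite.op (r.unop : A)

theorem opIncl_mem (r : (𝒜 0)ᵐᵒᵖ) : opIncl r ∈ opGrading 𝒜 0 := ⟨_, r.unop.2, rfl⟩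

variable [GradedAlgebra 𝒜]

/-- The projection of a nonnegatively graded ring onto its degree `0` part. -/
def projDegreeZero (h𝒜 : ∀ i < 0, 𝒜 i = ⊥) : A →+* 𝒜 0 where
  toFun a := DirectSum.decompose 𝒜 a 0
  map_zero' := by simp
  map_add' a b := by simp
  map_one' := Subtype.ext (DirectSum.decompose_of_mem_same 𝒜 SetLike.GradedOne.one_mem)
  map_mul' a b := by
    apply Subtype.ext
    induction a using DirectSum.Decomposition.inductionOn 𝒜 with
    | zero => simp
    | add a a' ha ha' => simpa [add_mul] using congrArg₂ (· + ·) ha ha'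
    | homogeneous a =>
      rename_i i
      induction b using DirectSum.Decomposition.inductionOn 𝒜 with
      | zero => simp
      | add b b' hb hb' => simpa [mul_add] using congrArg₂ (· + ·) hb hb'
      | homogeneous b =>
        rename_i j
        -- The only threat is a degree 0 product with i = -j ≠ 0; then one factor has negative
        -- degree and is zero.
        have hab : (a : A) * b ∈ 𝒜 (i + j) := SetLike.mul_mem_graded a.2 b.2
        rcases lt_trichotomy i 0 with hi | rfl | hi
        · have : (a : A) = 0 := by simpa [h𝒜 i hi] using a.2
          simp [this]
        · rcases lt_trichotomy j 0 with hj | rfl | hj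
          · have : (b : A) = 0 := by simpa [h𝒜 j hj] using b.2
            simp [this]
          · change (DirectSum.decompose 𝒜 ((a : A) * b) 0 : A) =
              (DirectSum.decompose 𝒜 (a : A) 0 : A) * (DirectSum.decompose 𝒜 (b : A) 0 : A)
            rw [DirectSum.decompose_of_mem_same 𝒜 (by simpa using hab),
              DirectSum.decompose_of_mem_same 𝒜 a.2,
              DirectSum.decompose_of_mem_same 𝒜 b.2]
          · change (DirectSum.decompose 𝒜 ((a : A) * b) 0 : A) =
              (DirectSum.decompose 𝒜 (a : A) 0 : A) * (DirectSum.decompose 𝒜 (b : A) 0 : A)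
            rw [DirectSum.decompose_of_mem_ne 𝒜 hab (by lia),
              DirectSum.decompose_of_mem_ne 𝒜 b.2 (by lia), mul_zero]
        · change (DirectSum.decompose 𝒜 ((a : A) * b) 0 : A) =
              (DirectSum.decompose 𝒜 (a : A) 0 : A) * (DirectSum.decompose 𝒜 (b : A) 0 : A)
          rw [DirectSum.decompose_of_mem_ne 𝒜 a.2 (by lia), zero_mul]
          rcases lt_or_ge j 0 with hj | hj
          · have : (b : A) = 0 := by simpa [h𝒜 j hj] using b.2
            simp [this]
          · exact DirectSum.decompose_of_mem_ne 𝒜 hab (by lia)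

theorem projDegreeZero_coe (h𝒜 : ∀ i < 0, 𝒜 i = ⊥) (a : 𝒜 0) :
    projDegreeZero h𝒜 (a : A) = a :=
  Subtype.ext (DirectSum.decompose_of_mem_same 𝒜 a.2)

theorem projDegreeZero_of_mem (h𝒜 : ∀ i < 0, 𝒜 i = ⊥) {i : ℤ} {a : A} (ha : a ∈ 𝒜 i)
    (hi : i ≠ 0) : projDegreeZero h𝒜 a = 0 :=
  Subtype.ext (DirectSum.decompose_of_mem_ne 𝒜 ha hi)

/-- The opposite of `projDegreeZero`. -/
def opProj (h𝒜 : ∀ i < 0, 𝒜 i = ⊥) : Aᵐᵒᵖ →+* (𝒜 0)ᵐᵒᵖ := (projDegreeZero h𝒜).op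

theorem opProj_opIncl (h𝒜 : ∀ i < 0, 𝒜 i = ⊥) (r : (𝒜 0)ᵐᵒᵖ) : opProj h𝒜 (opIncl r) = r :=
  MulOpposite.unop_injective (projDegreeZero_coe h𝒜 r.unop)

theorem opProj_of_mem (h𝒜 : ∀ i < 0, 𝒜 i = ⊥) {i : ℤ} {a : Aᵐᵒᵖ} (ha : a ∈ opGrading 𝒜 i)
    (hi : i ≠ 0) : opProj h𝒜 a = 0 := by
  obtain ⟨b, hb, rfl⟩ := ha
  exact MulOpposite.unop_injective (projDegreeZero_of_mem h𝒜 hb hi)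

theorem opIncl_opProj_of_mem (h𝒜 : ∀ i < 0, 𝒜 i = ⊥) {a : Aᵐᵒᵖ} (ha : a ∈ opGrading 𝒜 0) :
    opIncl (opProj h𝒜 a) = a := by
  obtain ⟨b, hb, rfl⟩ := ha
  exact MulOpposite.unop_injective (DirectSum.decompose_of_mem_same 𝒜 hb)

instance (h𝒜 : ∀ i < 0, 𝒜 i = ⊥) : RingHomSurjective (opProj h𝒜) :=
  ⟨fun r => ⟨_, opProj_opIncl h𝒜 r⟩⟩

namespace GrMod

instance (M : RightGrMod 𝒜) : SMul (𝒜 0)ᵐᵒᵖ (M.deg 0) :=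
  ⟨fun r m => ⟨opIncl r • (m : M), by
    have := M.smul_mem (opIncl_mem r) m.2
    rwa [zero_add] at this⟩⟩

/-- The degree `0` part of a graded right module is a right module over `𝒜 0`. -/
instance (M : RightGrMod 𝒜) : Module (𝒜 0)ᵐᵒᵖ (M.deg 0) where
  one_smul m := Subtype.ext (one_smul Aᵐᵒᵖ (m : M))
  mul_smul r s m := Subtype.ext (mul_smul (opIncl r) (opIncl s) (m : M))
  smul_zero r := Subtype.ext (smul_zero (opIncl r))
  smul_add r m n := Subtype.ext (smul_add (opIncl r) (m : M) n)
  add_smul r s m := Subtype.ext (add_smul (opIncl r) (opIncl s) (m : M))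
  zero_smul m := Subtype.ext (zero_smul Aᵐᵒᵖ (m : M))

/-- The map induced on degree `0` parts. -/
def degZeroMap {M N : RightGrMod 𝒜} (f : M ⟶ N) : M.deg 0 →ₗ[(𝒜 0)ᵐᵒᵖ] N.deg 0 where
  toFun m := ⟨lin f m, lin_mem f m.2⟩
  map_add' m n := Subtype.ext (map_add (lin f) (m : M) n)
  map_smul' r m := Subtype.ext (map_smul (lin f) (opIncl r) (m : M))

theorem degZeroMap_injective {M N : RightGrMod 𝒜} (f : M ⟶ N) (hf : Function.Injective (lin f)) :
    Function.Injective (degZeroMap f) := fun _ _ h =>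
  Subtype.ext (hf (congrArg Subtype.val h))

theorem degZeroMap_surjective {M N : RightGrMod 𝒜} (f : M ⟶ N)
    (hf : Function.Surjective (lin f)) : Function.Surjective (degZeroMap f) := by
  rintro ⟨n, hn⟩
  obtain ⟨m, rfl⟩ := hf n
  obtain ⟨m', hm', h⟩ := exists_mem_deg f hn
  exact ⟨⟨m', hm'⟩, Subtype.ext h⟩

theorem degZeroMap_exact [IsNoetherianRing Aᵐᵒᵖ] {M N : RightGrMod 𝒜} (f : M ⟶ N) :
    Function.Exact (degZeroMap (kerι f)) (degZeroMap f) := by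
  rintro ⟨m, hm⟩
  constructor
  · intro h
    exact ⟨⟨(⟨m, congrArg Subtype.val h⟩ : LinearMap.ker (lin f)), hm⟩, rfl⟩
  · rintro ⟨x, hx⟩
    have : m = lin (kerι f) (x : ker f) := congrArg Subtype.val hx.symm
    exact Subtype.ext ((congrArg (lin f) this).trans (congrArg (fun φ => lin φ x) (kerι_comp f)))

section Inflate

variable (h𝒜 : ∀ i < 0, 𝒜 i = ⊥) (N : Type u) [AddCommGroup N] [Module (𝒜 0)ᵐᵒᵖ N]

/-- The `Aᵐᵒᵖ`-module on a module over the degree `0` part. -/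
@[reducible]
def inflateModule : Module Aᵐᵒᵖ N := Module.compHom N (opProj h𝒜)

/-- A submodule over `Aᵐᵒᵖ` is a submodule over the degree `0` part. -/
def submoduleOfInflate (p : letI := inflateModule h𝒜 N; Submodule Aᵐᵒᵖ N) :
    Submodule (𝒜 0)ᵐᵒᵖ N :=
  letI := inflateModule h𝒜 N
  { carrier := p
    add_mem' := p.add_mem
    zero_mem' := p.zero_mem
    smul_mem' := fun r x hx => by
      have : opIncl r • x ∈ p := p.smul_mem _ hx
      change opProj h𝒜 (opIncl r) • x ∈ p at this
      rwa [opProj_opIncl] at this }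

/-- A finitely generated module over the degree `0` part, as a graded module concentrated in
degree `0`. -/
def inflate [Module.Finite (𝒜 0)ᵐᵒᵖ N] : RightGrMod 𝒜 :=
  letI := inflateModule h𝒜 N
  { carrier := N
    deg := fun i => if i = 0 then ⊤ else ⊥
    isInternal := by
      refine isInternal_of_components _ (fun i => if i = 0 then AddMonoidHom.id N else 0) ?_ ?_ ?_
      · intro i x hx
        split_ifs at hx ⊢ with h
        · rfl
        · exact hx.symm
      · intro i j x hij hx
        split_ifs at hx ⊢ with h h'
        · exact absurd (h.trans h'.symm) hij
        · exact hx
        · rfl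
        · rfl
      · intro x
        exact AddSubgroup.mem_iSup_of_mem 0 (by simp)
    smul_mem := by
      intro i j r m hr hm
      by_cases hj : j = 0
      · by_cases hi : i = 0
        · simp [hi, hj]
        · have : r • m = 0 := by
            change opProj h𝒜 r • m = 0
            rw [opProj_of_mem h𝒜 hr hi]
            exact zero_smul (𝒜 0)ᵐᵒᵖ m
          rw [this]
          exact zero_mem _
      · rw [if_neg hj] at hm
        rw [show m = 0 from hm, smul_zero]
        exact zero_mem _
    finite := by
      obtain ⟨t, ht⟩ := (inferInstance : Module.Finite (𝒜 0)ᵐᵒᵖ N).fg_top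
      refine ⟨t, eq_top_iff.2 fun x _ => ?_⟩
      have : Submodule.span (𝒜 0)ᵐᵒᵖ (t : Set N) ≤
          submoduleOfInflate h𝒜 N (Submodule.span Aᵐᵒᵖ t) :=
        Submodule.span_le.2 fun y hy => Submodule.subset_span hy
      exact this (ht ▸ trivial) }

theorem mem_inflate_deg_zero [Module.Finite (𝒜 0)ᵐᵒᵖ N] (x : inflate h𝒜 N) :
    x ∈ (inflate h𝒜 N).deg 0 := trivial

theorem inflate_isConcentratedInDegreeZero [Module.Finite (𝒜 0)ᵐᵒᵖ N] :
    (inflate h𝒜 N).IsConcentratedInDegreeZero := fun _ hi => if_neg hi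

variable {N} in
/-- Inflation of a linear map. -/
def inflateMap [Module.Finite (𝒜 0)ᵐᵒᵖ N] {N' : Type u} [AddCommGroup N'] [Module (𝒜 0)ᵐᵒᵖ N']
    [Module.Finite (𝒜 0)ᵐᵒᵖ N'] (f : N →ₗ[(𝒜 0)ᵐᵒᵖ] N') : inflate h𝒜 N ⟶ inflate h𝒜 N' :=
  ofLin
    { toFun := fun x : N => (f x : N')
      map_add' := map_add f
      map_smul' := fun r (x : N) => f.map_smul (opProj h𝒜 r) x } (by
    intro i m hm
    by_cases hi : i = 0
    · subst hi
      exact mem_inflate_deg_zero h𝒜 _ _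
    · rw [inflate_isConcentratedInDegreeZero h𝒜 _ i hi] at hm ⊢
      exact (congrArg f hm).trans (map_zero f))

/-- Submodules over A embed strictly monotonically into submodules over A_0, so both chain
conditions pull back. -/
theorem isFiniteLength_inflate [Module.Finite (𝒜 0)ᵐᵒᵖ N] [IsArtinian (𝒜 0)ᵐᵒᵖ N]
    [IsNoetherian (𝒜 0)ᵐᵒᵖ N] : IsFiniteLength Aᵐᵒᵖ (inflate h𝒜 N) := by
  let _ := inflateModule h𝒜 N
  have hmono : StrictMono (submoduleOfInflate h𝒜 N) := fun p q hpq => hpq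
  rw [isFiniteLength_iff_isNoetherian_isArtinian]
  exact ⟨isNoetherian_iff'.2 (hmono.wellFoundedGT), ⟨hmono.wellFoundedLT.wf⟩⟩

theorem shortExact_inflate [IsNoetherianRing Aᵐᵒᵖ] {N₁ N₂ N₃ : Type u} [AddCommGroup N₁]
    [Module (𝒜 0)ᵐᵒᵖ N₁] [Module.Finite (𝒜 0)ᵐᵒᵖ N₁] [AddCommGroup N₂] [Module (𝒜 0)ᵐᵒᵖ N₂]
    [Module.Finite (𝒜 0)ᵐᵒᵖ N₂] [AddCommGroup N₃] [Module (𝒜 0)ᵐᵒᵖ N₃]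
    [Module.Finite (𝒜 0)ᵐᵒᵖ N₃] (f : N₁ →ₗ[(𝒜 0)ᵐᵒᵖ] N₂) (g : N₂ →ₗ[(𝒜 0)ᵐᵒᵖ] N₃)
    (hf : Function.Injective f) (hg : Function.Surjective g) (h : Function.Exact f g) :
    (ShortComplex.mk (inflateMap h𝒜 f) (inflateMap h𝒜 g)
      (hom_ext' h.apply_apply_eq_zero)).ShortExact :=
  shortExact_of_exact _ _ _ hf hg h

theorem simple_inflate [IsNoetherianRing Aᵐᵒᵖ] [Module.Finite (𝒜 0)ᵐᵒᵖ N]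
    [IsSimpleModule (𝒜 0)ᵐᵒᵖ N] : Simple (inflate h𝒜 N) where
  mono_isIso_iff_nonzero {Y} f _ := by
    have := IsSimpleModule.nontrivial (𝒜 0)ᵐᵒᵖ N
    let _ := inflateModule h𝒜 N
    constructor
    · rintro hf rfl
      obtain ⟨x, hx⟩ := exists_ne (0 : N)
      have h : 𝟙 (inflate h𝒜 N) = 0 := by
        rw [← IsIso.inv_hom_id (0 : Y ⟶ inflate h𝒜 N), comp_zero]
      exact hx (congrArg (fun φ : inflate h𝒜 N ⟶ inflate h𝒜 N => lin φ x) h)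
    · intro hf
      refine isIso_of_bijective f ⟨lin_injective_of_mono f, fun x => ?_⟩
      rcases eq_bot_or_eq_top (submoduleOfInflate h𝒜 N (LinearMap.range (lin f))) with h | h
      · refine absurd (hom_ext' fun y => ?_) hf
        have : lin f y ∈ submoduleOfInflate h𝒜 N (LinearMap.range (lin f)) := ⟨y, rfl⟩
        rw [h] at this
        exact this
      · have : x ∈ submoduleOfInflate h𝒜 N (LinearMap.range (lin f)) := by rw [h]; trivial
        exact this

end Inflate

/-- With both gradings nonnegative, only degree 0 acting on degree 0 contributes to degree 0.
Equivalently, M_{>0} is a submodule whose quotient is the inflation of M_0. -/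
theorem comp_zero_smul (h𝒜 : ∀ i < 0, 𝒜 i = ⊥) (M : RightGrMod 𝒜) (hM : ∀ i < 0, M.deg i = ⊥)
    (r : Aᵐᵒᵖ) (m : M) : M.comp 0 (r • m) = opIncl (opProj h𝒜 r) • M.comp 0 m := by
  obtain ⟨a, rfl⟩ := MulOpposite.op_surjective r
  induction a using DirectSum.Decomposition.inductionOn 𝒜 with
  | zero =>
    rw [MulOpposite.op_zero, map_zero, zero_smul, map_zero]
    exact (zero_smul Aᵐᵒᵖ _).symm
  | add a b ha hb =>
    rw [MulOpposite.op_add, map_add, add_smul, map_add, ha, hb]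
    exact (add_smul (opIncl _) (opIncl _) (M.comp 0 m)).symm
  | homogeneous a =>
    rename_i i
    have ha : MulOpposite.op (a : A) ∈ opGrading 𝒜 i := ⟨a, a.2, rfl⟩
    refine M.induction_homogeneous (p := fun m => M.comp 0 (MulOpposite.op (a : A) • m) =
      opIncl (opProj h𝒜 (MulOpposite.op (a : A))) • M.comp 0 m)
      ?_ (fun m n hm hn => ?_) (fun j m hm => ?_) m
    · rw [smul_zero, map_zero, smul_zero]
    · rw [smul_add, map_add, hm, hn, map_add, smul_add]
    · have ham := M.smul_mem ha hm
      by_cases hj : j = 0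
      · subst hj
        by_cases hi : i = 0
        · subst hi
          rw [opIncl_opProj_of_mem h𝒜 ha]
          rw [zero_add] at ham
          exact (gradedComponent_of_mem M.isInternal ham).trans
            (congrArg _ (gradedComponent_of_mem M.isInternal hm).symm)
        · rw [opProj_of_mem h𝒜 ha hi]
          exact (gradedComponent_of_mem_ne M.isInternal (by lia) ham).trans
            (zero_smul Aᵐᵒᵖ _).symm
      · have h0 : M.comp 0 m = 0 := gradedComponent_of_mem_ne M.isInternal (Ne.symm hj) hm
        rw [h0, smul_zero]
        by_cases hij : i + j = 0
        · rcases lt_or_gt_of_ne hj with hj | hj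
          · rw [hM j hj] at hm
            rw [show m = 0 from hm, smul_zero, map_zero]
          · have : (a : A) = 0 := by simpa [h𝒜 i (by lia)] using a.2
            rw [this, MulOpposite.op_zero, zero_smul, map_zero]
        · exact gradedComponent_of_mem_ne M.isInternal (Ne.symm hij) ham

/-- The projection of a nonnegatively graded module onto its degree `0` part. -/
noncomputable def projDegZero (h𝒜 : ∀ i < 0, 𝒜 i = ⊥) (M : RightGrMod 𝒜)
    (hM : ∀ i < 0, M.deg i = ⊥) : M →ₛₗ[opProj h𝒜] M.deg 0 where
  toFun m := ⟨M.comp 0 m, gradedComponent_mem M.isInternal 0 m⟩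
  map_add' m n := Subtype.ext (map_add (M.comp 0) m n)
  map_smul' r m := Subtype.ext (comp_zero_smul h𝒜 M hM r m)

theorem projDegZero_coe (h𝒜 : ∀ i < 0, 𝒜 i = ⊥) (M : RightGrMod 𝒜)
    (hM : ∀ i < 0, M.deg i = ⊥) (m : M.deg 0) : projDegZero h𝒜 M hM m = m :=
  Subtype.ext (gradedComponent_of_mem M.isInternal m.2)

theorem finite_degZero (h𝒜 : ∀ i < 0, 𝒜 i = ⊥) (M : RightGrMod 𝒜) (hM : ∀ i < 0, M.deg i = ⊥) :
    Module.Finite (𝒜 0)ᵐᵒᵖ (M.deg 0) :=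
  Module.Finite.of_surjective (projDegZero h𝒜 M hM) fun m => ⟨m, projDegZero_coe h𝒜 M hM m⟩

/-- The projection of a nonnegatively graded module onto its degree `0` part, as a morphism of
graded modules. -/
noncomputable def toInflate (h𝒜 : ∀ i < 0, 𝒜 i = ⊥) (M : RightGrMod 𝒜) (hM : ∀ i < 0, M.deg i = ⊥)
    [Module.Finite (𝒜 0)ᵐᵒᵖ (M.deg 0)] : M ⟶ inflate h𝒜 (M.deg 0) :=
  ofLin
    { toFun := projDegZero h𝒜 M hM
      map_add' := map_add (projDegZero h𝒜 M hM)
      map_smul' := (projDegZero h𝒜 M hM).map_smulₛₗ } (by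
    intro i m hm
    by_cases hi : i = 0
    · subst hi
      exact mem_inflate_deg_zero h𝒜 _ _
    · rw [inflate_isConcentratedInDegreeZero h𝒜 _ i hi]
      exact Subtype.ext (gradedComponent_of_mem_ne M.isInternal (Ne.symm hi) hm))

/-- The map from the degree `0` part induced by a morphism to an inflated module. -/
def ofInflateHom (h𝒜 : ∀ i < 0, 𝒜 i = ⊥) {M : RightGrMod 𝒜} {N : Type u} [AddCommGroup N]
    [Module (𝒜 0)ᵐᵒᵖ N] [Module.Finite (𝒜 0)ᵐᵒᵖ N] (f : M ⟶ inflate h𝒜 N) :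
    M.deg 0 →ₗ[(𝒜 0)ᵐᵒᵖ] N where
  toFun m := lin f m
  map_add' m n := map_add (lin f) (m : M) n
  map_smul' r m := by
    refine (map_smul (lin f) (opIncl r) (m : M)).trans ?_
    change opProj h𝒜 (opIncl r) • (show N from lin f m) = _
    rw [opProj_opIncl]
    rfl

/-- The degree `0` part of an inflated module is the given module. -/
noncomputable def degZeroInflateEquiv (h𝒜 : ∀ i < 0, 𝒜 i = ⊥) (N : Type u) [AddCommGroup N]
    [Module (𝒜 0)ᵐᵒᵖ N] [Module.Finite (𝒜 0)ᵐᵒᵖ N] :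
    (inflate h𝒜 N).deg 0 ≃ₗ[(𝒜 0)ᵐᵒᵖ] N :=
  LinearEquiv.ofBijective (ofInflateHom h𝒜 (𝟙 (inflate h𝒜 N)))
    ⟨fun _ _ h => Subtype.ext h, fun x => ⟨⟨x, mem_inflate_deg_zero h𝒜 N x⟩, rfl⟩⟩

end GrMod

end DegreeZero

/-! ### Transfer of Ext vanishing to the global dimension of A_0 -/

section GlobalDimension

variable {k : Type v} [Field k] {A : Type u} [Ring A] [Algebra k A] {𝒜 : ℤ → Submodule k A}

theorem GrMod.ker_deg_eq_bot [IsNoetherianRing Aᵐᵒᵖ] {M N : RightGrMod 𝒜} (f : M ⟶ N) {i : ℤ}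
    (h : M.deg i = ⊥) : (GrMod.ker f).deg i = ⊥ := by
  rw [eq_bot_iff]
  intro x hx
  have : GrMod.lin (GrMod.kerι f) x ∈ M.deg i := hx
  rw [h] at this
  exact Subtype.ext this

variable [GradedAlgebra 𝒜]

namespace GrMod

theorem projective_degZero_prod (M N : RightGrMod 𝒜) [Module.Projective (𝒜 0)ᵐᵒᵖ (M.deg 0)]
    [Module.Projective (𝒜 0)ᵐᵒᵖ (N.deg 0)] :
    Module.Projective (𝒜 0)ᵐᵒᵖ ((prod M N).deg 0) := by
  refine Module.Projective.of_equiv (M := M.deg 0 × N.deg 0)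
    (LinearEquiv.ofBijective ((degZeroMap (inl M N)).coprod (degZeroMap (inr M N))) ⟨?_, ?_⟩)
  · rw [injective_iff_map_eq_zero]
    rintro ⟨⟨m, hm⟩, ⟨n, hn⟩⟩ h
    have h : ((m + 0, 0 + n) : M × N) = 0 := congrArg Subtype.val h
    rw [add_zero, zero_add] at h
    exact Prod.ext (Subtype.ext (congrArg Prod.fst h)) (Subtype.ext (congrArg Prod.snd h))
  · rintro ⟨⟨m, n⟩, hm, hn⟩
    refine ⟨(⟨m, hm⟩, ⟨n, hn⟩), Subtype.ext ?_⟩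
    change ((m + 0, 0 + n) : M × N) = (m, n)
    rw [add_zero, zero_add]

theorem regularShift_deg_eq_bot (h𝒜 : ∀ i < 0, 𝒜 i = ⊥) {n i : ℤ} (h : n + i < 0) :
    (regularShift 𝒜 n).deg i = ⊥ := by
  change (𝒜 (n + i)).toAddSubgroup = ⊥
  rw [h𝒜 _ h]
  rfl

/-- The degree 0 part is A_0 for n = 0 and zero for n < 0. For n > 0 it would be A_n, which need not
be projective; this is why the covers are kept nonnegatively graded. -/
theorem projective_degZero_regularShift (h𝒜 : ∀ i < 0, 𝒜 i = ⊥) {n : ℤ} (hn : n ≤ 0) :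
    Module.Projective (𝒜 0)ᵐᵒᵖ ((regularShift 𝒜 n).deg 0) := by
  rcases hn.lt_or_eq with hn | rfl
  · have : Subsingleton ((regularShift 𝒜 n).deg 0) := by
      rw [regularShift_deg_eq_bot h𝒜 (by lia)]
      infer_instance
    infer_instance
  · refine Module.Projective.of_equiv (M := (𝒜 0)ᵐᵒᵖ) (LinearEquiv.ofBijective
      (LinearMap.toSpanSingleton (𝒜 0)ᵐᵒᵖ _ ⟨(1 : A),
        one_mem_regularShift (A := A) (𝒜 := 𝒜) (n := 0) (add_zero 0)⟩) ⟨?_, ?_⟩)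
    · intro r s h
      have h : 1 * (r.unop : A) = 1 * (s.unop : A) := congrArg Subtype.val h
      rw [one_mul, one_mul] at h
      exact MulOpposite.unop_injective (Subtype.ext h)
    · rintro ⟨a, ha⟩
      have ha' : (show A from a) ∈ 𝒜 0 := by
        change a ∈ 𝒜 (0 + 0) at ha
        rwa [add_zero] at ha
      exact ⟨MulOpposite.op ⟨a, ha'⟩, Subtype.ext (one_mul (show A from a))⟩

/-- A nonnegatively graded module is a quotient of a nonnegatively graded projective module with
projective degree `0` part. -/
theorem exists_nonneg_projective_cover (h𝒜 : ∀ i < 0, 𝒜 i = ⊥) (M : RightGrMod 𝒜)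
    (hM : ∀ i < 0, M.deg i = ⊥) :
    ∃ (P : RightGrMod 𝒜) (f : P ⟶ M), (Projective P ∧ (∀ i < 0, P.deg i = ⊥) ∧
      Module.Projective (𝒜 0)ᵐᵒᵖ (P.deg 0)) ∧ Function.Surjective (lin f) := by
  refine exists_surjection (fun P => Projective P ∧ (∀ i < 0, P.deg i = ⊥) ∧
      Module.Projective (𝒜 0)ᵐᵒᵖ (P.deg 0)) ?_ ?_ M ?_
  · have : Subsingleton (zero (opGrading 𝒜)) := inferInstanceAs (Subsingleton PUnit)
    exact ⟨(isZero_of_subsingleton _).projective, fun _ _ => Subsingleton.elim _ _, inferInstance⟩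
  · rintro P Q ⟨hP, hP', hP''⟩ ⟨hQ, hQ', hQ''⟩
    refine ⟨projective_prod hP hQ, fun i hi => ?_, projective_degZero_prod P Q⟩
    change (P.deg i).prod (Q.deg i) = ⊥
    rw [hP' i hi, hQ' i hi, AddSubgroup.bot_prod_bot]
  · intro i hi
    have hi : 0 ≤ i := not_lt.1 fun h => hi (hM i h)
    exact ⟨inferInstance, fun j hj => regularShift_deg_eq_bot h𝒜 (by lia),
      projective_degZero_regularShift h𝒜 (by lia)⟩

/-- If `Ext^1(M, N) = 0` for all modules `N` over the degree `0` part, then the degree `0` part of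
the nonnegatively graded module `M` is projective. -/
theorem projective_degZero_of_ext_eq_zero [IsNoetherianRing Aᵐᵒᵖ] [IsNoetherianRing (𝒜 0)ᵐᵒᵖ]
    (h𝒜 : ∀ i < 0, 𝒜 i = ⊥) (M : RightGrMod 𝒜) (hM : ∀ i < 0, M.deg i = ⊥)
    (h : ∀ (N : Type u) [AddCommGroup N] [Module (𝒜 0)ᵐᵒᵖ N] [Module.Finite (𝒜 0)ᵐᵒᵖ N],
      ∀ e : Abelian.Ext M (inflate h𝒜 N) 1, e = 0) :
    Module.Projective (𝒜 0)ᵐᵒᵖ (M.deg 0) := by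
  have := finite_degZero h𝒜 M hM
  obtain ⟨n, g, hg⟩ := Module.Finite.exists_fin' (𝒜 0)ᵐᵒᵖ (M.deg 0)
  have hS := shortExact_inflate h𝒜 (N₁ := LinearMap.ker g) (LinearMap.ker g).subtype g
    Subtype.val_injective hg g.exact_subtype_ker_map
  -- The obstruction to lifting M → M_0 along the inflated free cover `g` lies in Ext^1(M, ker g) =
  -- 0. In degree 0 the lift is a section of `g`.
  obtain ⟨q, hq⟩ := Abelian.Ext.covariant_sequence_exact₃ M hS
    (Abelian.Ext.mk₀ (toInflate h𝒜 M hM)) (zero_add 1) (h _ _)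
  obtain ⟨q, rfl⟩ := (Abelian.Ext.mk₀_bijective _ _).2 q
  rw [Abelian.Ext.mk₀_comp_mk₀] at hq
  have hq' := (Abelian.Ext.mk₀_bijective _ _).1 hq
  refine Module.Projective.of_split (ofInflateHom h𝒜 q) g (LinearMap.ext fun m => ?_)
  exact (congrArg (fun φ => lin φ (m : M)) hq').trans (projDegZero_coe h𝒜 M hM m)

/-- If `Ext^i(M, N) = 0` for `i > n` and all modules `N` over the degree `0` part, then the
degree `0` part of the nonnegatively graded module `M` has projective dimension at most `n`. -/
theorem hasProjectiveDimensionLT_degZero [IsNoetherianRing Aᵐᵒᵖ] [IsNoetherianRing (𝒜 0)ᵐᵒᵖ]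
    (h𝒜 : ∀ i < 0, 𝒜 i = ⊥) (n : ℕ) (M : RightGrMod 𝒜) (hM : ∀ i < 0, M.deg i = ⊥)
    (h : ∀ (N : Type u) [AddCommGroup N] [Module (𝒜 0)ᵐᵒᵖ N] [Module.Finite (𝒜 0)ᵐᵒᵖ N],
      ∀ i, n < i → ∀ e : Abelian.Ext M (inflate h𝒜 N) i, e = 0) :
    HasProjectiveDimensionLT (ModuleCat.of (𝒜 0)ᵐᵒᵖ (M.deg 0)) (n + 1) := by
  induction n generalizing M with
  | zero =>
    have := projective_degZero_of_ext_eq_zero h𝒜 M hM fun N _ _ _ => h N 1 zero_lt_one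
    exact hasProjectiveDimensionLT_one_of_projective _
  | succ n ih =>
    obtain ⟨P, f, ⟨hP, hP', hP''⟩, hf⟩ := exists_nonneg_projective_cover h𝒜 M hM
    have hS := shortExact_ker f hf
    -- Dimension shift: the connecting map sends `e` into Ext^{i+1}(M, N) = 0, so `e` comes from
    -- Ext^i(P, N), which is zero as i > n forces i ≥ 1.
    have hK := ih (ker f) (fun i hi => ker_deg_eq_bot f (hP' i hi)) fun N _ _ _ i hi e => by
      obtain ⟨e', rfl⟩ := Abelian.Ext.contravariant_sequence_exact₁ hS _ e (add_comm 1 i)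
        (h N _ (by lia) _)
      obtain ⟨i, rfl⟩ := Nat.exists_eq_add_one_of_ne_zero (n := i) (by lia)
      rw [Abelian.Ext.eq_zero_of_projective (P := P) e', Abelian.Ext.comp_zero]
    have hS' := moduleCat_shortExact_of_exact (degZeroMap (kerι f)) (degZeroMap f)
      (degZeroMap_injective _ Subtype.val_injective) (degZeroMap_surjective f hf)
      (degZeroMap_exact f)
    have hP₀ := (IsProjective.iff_projective (R := (𝒜 0)ᵐᵒᵖ) (P.deg 0)).1 hP''
    exact (hS'.hasProjectiveDimensionLT_X₃_iff n hP₀).2 hK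

/-- Vanishing of `Ext` from an inflated module can be checked on simple modules. -/
theorem ext_inflate_left_eq_zero [IsNoetherianRing Aᵐᵒᵖ] [IsNoetherianRing (𝒜 0)ᵐᵒᵖ]
    (h𝒜 : ∀ i < 0, 𝒜 i = ⊥) (X : RightGrMod 𝒜) (n : ℕ)
    (h : ∀ (N : Type u) [AddCommGroup N] [Module (𝒜 0)ᵐᵒᵖ N] [Module.Finite (𝒜 0)ᵐᵒᵖ N]
      [IsSimpleModule (𝒜 0)ᵐᵒᵖ N], ∀ e : Abelian.Ext (inflate h𝒜 N) X n, e = 0)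
    (N : Type u) [AddCommGroup N] [Module (𝒜 0)ᵐᵒᵖ N] (hN : IsFiniteLength (𝒜 0)ᵐᵒᵖ N) :
    ∀ [Module.Finite (𝒜 0)ᵐᵒᵖ N] (e : Abelian.Ext (inflate h𝒜 N) X n), e = 0 := by
  induction hN with
  | of_subsingleton =>
    rename_i N _ _ _
    intro _ e
    have : Subsingleton (inflate h𝒜 N) := inferInstanceAs (Subsingleton N)
    rw [← e.mk₀_id_comp, (IsZero.iff_id_eq_zero _).1 (isZero_of_subsingleton _),
      Abelian.Ext.mk₀_zero, Abelian.Ext.zero_comp]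
  | of_simple_quotient _ ih =>
    rename_i N _ _ N' _ _
    intro _ e
    have hS := shortExact_inflate h𝒜 N'.subtype N'.mkQ N'.injective_subtype N'.mkQ_surjective
      (LinearMap.exact_subtype_mkQ _)
    obtain ⟨e', rfl⟩ := Abelian.Ext.contravariant_sequence_exact₂ hS _ e (ih _)
    rw [h _ e', Abelian.Ext.comp_zero]

/-- Vanishing of `Ext` to an inflated module can be checked on simple modules. -/
theorem ext_inflate_right_eq_zero [IsNoetherianRing Aᵐᵒᵖ] [IsNoetherianRing (𝒜 0)ᵐᵒᵖ]
    (h𝒜 : ∀ i < 0, 𝒜 i = ⊥) (X : RightGrMod 𝒜) (n : ℕ)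
    (h : ∀ (N : Type u) [AddCommGroup N] [Module (𝒜 0)ᵐᵒᵖ N] [Module.Finite (𝒜 0)ᵐᵒᵖ N]
      [IsSimpleModule (𝒜 0)ᵐᵒᵖ N], ∀ e : Abelian.Ext X (inflate h𝒜 N) n, e = 0)
    (N : Type u) [AddCommGroup N] [Module (𝒜 0)ᵐᵒᵖ N] (hN : IsFiniteLength (𝒜 0)ᵐᵒᵖ N) :
    ∀ [Module.Finite (𝒜 0)ᵐᵒᵖ N] (e : Abelian.Ext X (inflate h𝒜 N) n), e = 0 := by
  induction hN with
  | of_subsingleton =>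
    rename_i N _ _ _
    intro _ e
    have : Subsingleton (inflate h𝒜 N) := inferInstanceAs (Subsingleton N)
    rw [← e.comp_mk₀_id, (IsZero.iff_id_eq_zero _).1 (isZero_of_subsingleton _),
      Abelian.Ext.mk₀_zero, Abelian.Ext.comp_zero]
  | of_simple_quotient _ ih =>
    rename_i N _ _ N' _ _
    intro _ e
    have hS := shortExact_inflate h𝒜 N'.subtype N'.mkQ N'.injective_subtype N'.mkQ_surjective
      (LinearMap.exact_subtype_mkQ _)
    obtain ⟨e', rfl⟩ := Abelian.Ext.covariant_sequence_exact₂ X hS e (h _ _)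
    rw [ih e', Abelian.Ext.zero_comp]

end GrMod

open GrMod

/-- The k-action on `𝒜 0` arises both from the submodule and from the algebra structure; the
explicit `Algebra.toModule` selects the latter. -/
theorem isArtinianRing_op_degZero [h : FiniteDimensional k (𝒜 0)] :
    IsArtinianRing (𝒜 0)ᵐᵒᵖ := by
  have : @Module.Finite k (𝒜 0) _ _ Algebra.toModule := h
  have : @Module.Finite k (𝒜 0)ᵐᵒᵖ _ _ Algebra.toModule :=
    @Module.Finite.equiv k (𝒜 0) (𝒜 0)ᵐᵒᵖ _ _ Algebra.toModule _ Algebra.toModule this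
      (MulOpposite.opLinearEquiv k)
  have : @IsScalarTower k (𝒜 0)ᵐᵒᵖ (𝒜 0)ᵐᵒᵖ Algebra.toSMul _ Algebra.toSMul := IsScalarTower.right
  exact @IsArtinianRing.of_finite k (𝒜 0)ᵐᵒᵖ _ _ Algebra.toModule this _ _

end GlobalDimension

/-- The conclusion concerns right A_0-modules; since A_0 is finite dimensional, its left and right
global dimensions agree. -/
theorem mainTheorem2 {k : Type v} [Field k] {A : Type u} [Ring A] [Algebra k A]
    (𝒜 : ℤ → Submodule k A) [GradedAlgebra 𝒜] [IsNoetherianRing A] [IsNoetherianRing Aᵐᵒᵖ]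
    (d : ℕ) (hA : IsNatGradedASGorenstein 𝒜 d) (hT : ∃ T : DsgZero 𝒜, IsSilting T) :
    HasFiniteGlobalDimension (𝒜 0)ᵐᵒᵖ := by
  obtain ⟨T, hT⟩ := hT
  have h𝒜 := hA.natGraded
  have := hA.locallyFinite 0
  have : IsArtinianRing (𝒜 0)ᵐᵒᵖ := isArtinianRing_op_degZero
  have hlen : ∀ (N : Type u) [AddCommGroup N] [Module (𝒜 0)ᵐᵒᵖ N] [Module.Finite (𝒜 0)ᵐᵒᵖ N],
      IsFiniteLength (𝒜 0)ᵐᵒᵖ N := fun N _ _ _ =>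
    isFiniteLength_iff_isNoetherian_isArtinian.2 ⟨inferInstance, inferInstance⟩
  -- One module having all simples as summands, so that a single pair (G, G) yields a uniform bound.
  let G := (𝒜 0)ᵐᵒᵖ ⧸ Ring.jacobson (𝒜 0)ᵐᵒᵖ
  have hG : ∀ P : RightGrMod 𝒜, Projective P → ∀ j, d < j →
      ∀ e : Abelian.Ext (GrMod.inflate h𝒜 G) P j, e = 0 := fun P hP j hj =>
    GrMod.ext_eq_zero_of_projective (fun i => GrMod.ext_inflate_left_eq_zero h𝒜 _ j
      (fun N _ _ _ _ e => by
        have := hA.ext_eq_zero _ (GrMod.simple_inflate h𝒜 N)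
          (GrMod.inflate_isConcentratedInDegreeZero h𝒜 N) j hj.ne' i
        exact Subsingleton.elim _ _) G (hlen G)) P
  have hGlen : IsFiniteLength Aᵐᵒᵖ (GrMod.inflate h𝒜 G) := GrMod.isFiniteLength_inflate h𝒜 G
  obtain ⟨n, hn⟩ := exists_forall_ext_eq_zero_of_silting 𝒜 hT hGlen hGlen hG
  have hext : ∀ (N : Type u) [AddCommGroup N] [Module (𝒜 0)ᵐᵒᵖ N] [Module.Finite (𝒜 0)ᵐᵒᵖ N],
      ∀ i, n < i → ∀ e : Abelian.Ext (GrMod.inflate h𝒜 G) (GrMod.inflate h𝒜 N) i, e = 0 := by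
    intro N _ _ _ i hi
    refine GrMod.ext_inflate_right_eq_zero h𝒜 _ i (fun S _ _ _ _ e => ?_) N (hlen N)
    obtain ⟨s, r, hrs⟩ := exists_retract_quotient_jacobson (R := (𝒜 0)ᵐᵒᵖ) S
    have h : GrMod.inflateMap h𝒜 s ≫ GrMod.inflateMap h𝒜 r = 𝟙 _ :=
      GrMod.hom_ext' fun x => LinearMap.congr_fun hrs x
    rw [← e.comp_mk₀_id, ← h, ← Abelian.Ext.mk₀_comp_mk₀,
      ← Abelian.Ext.comp_assoc_of_second_deg_zero, hn i hi.le (e.comp _ _), Abelian.Ext.zero_comp]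
  have hpd := GrMod.hasProjectiveDimensionLT_degZero h𝒜 n (GrMod.inflate h𝒜 G)
    (fun i hi => GrMod.inflate_isConcentratedInDegreeZero h𝒜 G i hi.ne) hext
  refine ⟨n, fun M => hasProjectiveDimensionLT_of_quotient_jacobson (n + 1) ?_ M⟩
  exact hasProjectiveDimensionLT_of_linear_retract
    (N := (GrMod.inflate h𝒜 G).deg 0) (GrMod.degZeroInflateEquiv h𝒜 G).symm.toLinearMap
    (GrMod.degZeroInflateEquiv h𝒜 G).toLinearMap (LinearMap.ext fun x => by simp) (n + 1)
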